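/- Let $n\ge 1$, let $\gamma(x)=(2\pi)^{-n/2}e^{-|x|^2/2}$ be the standard Gaussian density on $\mathbb R^n$, and write $\gamma$ also for the measure $\gamma(x)\,dx$. Put $\cosh_2(x)=\cosh x-1$. Let $L^{\cosh_2}_1(\gamma)$ and $L^{\cosh_2}_2(\gamma)$ be the Orlicz spaces of the Young functions $x\mapsto\cosh_2(x)$ and $x\mapsto\cosh_2(x^2)$; for a Young function $\Phi$ the norm is the Luxemburg norm $\|f\|=\inf\{r>0:\int\Phi(|f|/r)\,d\gamma\le 1\}$. Let $$W^1L^{\cosh_2}_{1,2}(\gamma)=\{f\in L^{\cosh_2}_1(\gamma):\ \partial_i f\in L^{\cosh_2}_2(\gamma),\ i=1,\dots,n\},\qquad \|f\|=\|f\|_{L^{\cosh_2}_1(\gamma)}+\sum_{i=1}^n\|\partial_i f\|_{L^{\cosh_2}_2(\gamma)},$$ where $\partial_i f$ is the weak derivative defined by $\int \partial_i f\,\phi\,d\gamma=\int f\,(x_i\phi-\partial_i\phi)\,d\gamma$ for all compactly supported $\phi\in C^1(\mathbb R^n)$. For $\rho>0$ let $B_\rho=\{|x|<\rho\}$; for $1\le\alpha<\infty$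 let $W^{1,\alpha}(B_\rho)$ be the Sobolev space with norm $\|f\|_{L^\alpha(B_\rho)}+\sum_i\|\partial_i f\|_{L^\alpha(B_\rho)}$, and for $0<\lambda<1$ let $C^\lambda(\overline B_\rho)$ be the space of $\lambda$-Hölder functions on the closed ball with norm $\sup|u|+\sup_{x\ne y}|u(x)-u(y)|/|x-y|^\lambda$. Let $W^{1,\alpha}_{\mathrm{loc}}$ be the space of functions on $\mathbb R^n$ whose restriction to $B_\rho$ is in $W^{1,\alpha}(B_\rho)$ for every $\rho>0$. (1) For all $\rho>0$ and $1\le\alpha<\infty$, restriction to $B_\rho$ is a continuous linear map $W^1L^{\cosh_2}_{1,2}(\gamma)\to W^{1,\alpha}(B_\rho)$. For all $\rho>0$, $0<\lambda<1$ and $1\le\alpha<\infty$ with $\alpha\ge n/(1-\lambda)$ there is a continuous linear embedding $W^{1,\alpha}(B_\rho)\subset C^\lambda(\overline B_\rho)$: each $u\in W^{1,\alpha}(B_\rho)$ agrees a.e. on $B_\rho$ with a function in $C^\lambda(\overline B_\rho)$, and the map so defined is linear, injective and continuous. (2) The inclusions $$W^1L^{\cosh_2}_{1,2}(\gamma)\subset\bigcap_{1\le\alpha<\infty}W^{1,\alpha}_{\mathrm{loc}}\cap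 L^{\cosh_2}_1(\gamma)\subset C(\mathbb R^n)\cap L^{\cosh_2}_1(\gamma)$$ hold and are continuous, linear and injective. Here the middle space has the coarsest topology that makes the inclusion in $L^{\cosh_2}_1(\gamma)$ and all the restrictions to $W^{1,\alpha}(B_\rho)$ ($1\le\alpha<\infty$, $\rho>0$) continuous; $C(\mathbb R^n)$ has the topology of uniform convergence on compact sets, and the last space has the coarsest topology that makes its inclusions in $C(\mathbb R^n)$ and in $L^{\cosh_2}_1(\gamma)$ continuous. In the last inclusion each element is identified with its continuous version. In particular, every element of $W^1L^{\cosh_2}_{1,2}(\gamma)$ has a continuous version. -/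

import Mathlib

open MeasureTheory Set
open scoped ENNReal NNReal

namespace OrliczSobolev

/-! ## Young functions -/

/-- A (finite-valued) Young function: an even convex function on the line, vanishing at `0` and
tending to infinity at infinity. Every primitive `x ↦ ∫ u in 0..|x|, φ u` of a strictly increasing
continuous `φ` on `[0, ∞)` with `φ 0 = 0` and limit `∞` is one. -/
structure YoungFunction where
  toFun : ℝ → ℝ
  map_zero' : toFun 0 = 0
  even' : ∀ x, toFun (-x) = toFun x
  convexOn' : ConvexOn ℝ univ toFun
  tendsto' : Filter.Tendsto toFun Filter.atTop Filter.atTop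

namespace YoungFunction

instance : CoeFun YoungFunction (fun _ => ℝ → ℝ) := ⟨YoungFunction.toFun⟩

variable (Φ : YoungFunction)

theorem map_abs (x : ℝ) : Φ |x| = Φ x := by
  rcases abs_choice x with h | h <;> rw [h]
  exact Φ.even' x

theorem nonneg (x : ℝ) : 0 ≤ Φ x := by
  have h := Φ.convexOn'.2 (mem_univ x) (mem_univ (-x)) (by norm_num : (0 : ℝ) ≤ 1 / 2)
    (by norm_num : (0 : ℝ) ≤ 1 / 2) (by norm_num)
  have h0 : (1 / 2 : ℝ) • x + (1 / 2 : ℝ) • (-x) = 0 := by simp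
  rw [h0, Φ.map_zero', Φ.even'] at h
  simp only [smul_eq_mul] at h
  linarith

theorem map_mul_le {t : ℝ} (ht0 : 0 ≤ t) (ht1 : t ≤ 1) (x : ℝ) : Φ (t * x) ≤ t * Φ x := by
  have h := Φ.convexOn'.2 (mem_univ x) (mem_univ 0) ht0 (sub_nonneg.2 ht1) (by ring)
  simpa [Φ.map_zero'] using h

theorem mono {x y : ℝ} (hx : 0 ≤ x) (hxy : x ≤ y) : Φ x ≤ Φ y := by
  rcases hx.eq_or_lt with rfl | hx'
  · rw [Φ.map_zero']
    exact Φ.nonneg y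
  · have hy : 0 < y := hx'.trans_le hxy
    have h := Φ.map_mul_le (t := x / y) (by positivity) ((div_le_one hy).2 hxy) y
    rw [div_mul_cancel₀ _ hy.ne'] at h
    exact h.trans (mul_le_of_le_one_left (Φ.nonneg y) ((div_le_one hy).2 hxy))

theorem continuous : Continuous Φ := by
  rw [← continuousOn_univ]
  exact Φ.convexOn'.continuousOn isOpen_univ

theorem exists_abs_le : ∃ a b : ℝ, 0 ≤ a ∧ 0 ≤ b ∧ ∀ x, |x| ≤ a + b * Φ x := by
  obtain ⟨c, hc0, hc⟩ := ((Filter.eventually_gt_atTop (0 : ℝ)).and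
    (Φ.tendsto'.eventually_ge_atTop 1)).exists
  refine ⟨c, c, hc0.le, hc0.le, fun x => ?_⟩
  rcases le_total |x| c with h | h
  · exact h.trans (le_add_of_nonneg_right (mul_nonneg hc0.le (Φ.nonneg x)))
  · have hx : 0 < |x| := hc0.trans_le h
    have h1 := Φ.map_mul_le (t := c / |x|) (by positivity) ((div_le_one hx).2 h) |x|
    rw [div_mul_cancel₀ _ hx.ne', Φ.map_abs, div_mul_eq_mul_div, le_div_iff₀ hx] at h1
    nlinarith

/-- The Young function `x ↦ Φ (x ^ 2)`. -/
def sq : YoungFunction where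
  toFun x := Φ (x ^ 2)
  map_zero' := by simp [Φ.map_zero']
  even' x := by simp
  convexOn' := by
    refine ⟨convex_univ, fun x _ y _ a b ha hb hab => ?_⟩
    have h1 : (a • x + b • y) ^ 2 ≤ a • x ^ 2 + b • y ^ 2 := by
      obtain rfl : b = 1 - a := by linarith
      simp only [smul_eq_mul]
      nlinarith [mul_nonneg (mul_nonneg ha hb) (sq_nonneg (x - y))]
    exact (Φ.mono (sq_nonneg _) h1).trans (Φ.convexOn'.2 (mem_univ _) (mem_univ _) ha hb hab)
  tendsto' := Φ.tendsto'.comp (Filter.tendsto_pow_atTop two_ne_zero)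

end YoungFunction

/-- The Young function `cosh₂ x = cosh x - 1`. -/
noncomputable def cosh₂ : YoungFunction where
  toFun x := Real.cosh x - 1
  map_zero' := by simp
  even' x := by simp
  convexOn' := by
    have h : ConvexOn ℝ univ Real.cosh := by
      refine convexOn_of_deriv2_nonneg convex_univ Real.continuous_cosh.continuousOn
        Real.differentiable_cosh.differentiableOn ?_ ?_
      · simpa using Real.differentiable_sinh.differentiableOn
      · intro x _
        simpa using (Real.cosh_pos x).le
    exact h.add_const (-1)
  tendsto' := by
    refine Filter.tendsto_atTop_mono (f := fun x => Real.exp x / 2 - 1) (fun x => ?_) ?_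
    · rw [Real.cosh_eq]
      have := (Real.exp_pos (-x)).le
      linarith
    · exact Filter.tendsto_atTop_add_const_right _ _
        (Real.tendsto_exp_atTop.atTop_div_const two_pos)

/-! ## Orlicz spaces -/

section Orlicz

variable {Ω : Type*} [MeasurableSpace Ω] (Φ : YoungFunction) (μ : Measure Ω)

/-- The modular `∫ Φ(|f|) dμ`. -/
noncomputable def modular (f : Ω →ₘ[μ] ℝ) : ℝ≥0∞ := ∫⁻ ω, ENNReal.ofReal (Φ |f ω|) ∂μ

variable {μ}

theorem modular_zero : modular Φ μ 0 = 0 := by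
  have h : (fun ω => ENNReal.ofReal (Φ |(0 : Ω →ₘ[μ] ℝ) ω|)) =ᵐ[μ] fun _ => 0 := by
    filter_upwards [AEEqFun.coeFn_zero (μ := μ) (β := ℝ)] with ω h
    simp [h, Φ.map_zero']
  rw [modular, lintegral_congr_ae h, lintegral_zero]

theorem modular_convex {a b : ℝ} (ha : 0 ≤ a) (hb : 0 ≤ b) (hab : a + b = 1)
    (f g : Ω →ₘ[μ] ℝ) :
    modular Φ μ (a • f + b • g)
      ≤ ENNReal.ofReal a * modular Φ μ f + ENNReal.ofReal b * modular Φ μ g := by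
  have hm : ∀ u : Ω →ₘ[μ] ℝ, AEMeasurable (fun ω => ENNReal.ofReal (Φ |u ω|)) μ := fun u =>
    (ENNReal.measurable_ofReal.comp
      (Φ.continuous.measurable.comp continuous_abs.measurable)).comp_aemeasurable
        u.aestronglyMeasurable.aemeasurable
  rw [modular, modular, modular, ← lintegral_const_mul' _ _ ENNReal.ofReal_ne_top,
    ← lintegral_const_mul' _ _ ENNReal.ofReal_ne_top,
    ← lintegral_add_left' ((hm f).const_mul _)]
  refine lintegral_mono_ae ?_
  filter_upwards [AEEqFun.coeFn_add (a • f) (b • g), AEEqFun.coeFn_smul a f,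
    AEEqFun.coeFn_smul b g] with ω h1 h2 h3
  rw [h1, Pi.add_apply, h2, h3, Pi.smul_apply, Pi.smul_apply, ← ENNReal.ofReal_mul ha,
    ← ENNReal.ofReal_mul hb, ← ENNReal.ofReal_add (mul_nonneg ha (Φ.nonneg _))
      (mul_nonneg hb (Φ.nonneg _))]
  refine ENNReal.ofReal_le_ofReal ?_
  simp only [Φ.map_abs]
  exact Φ.convexOn'.2 (mem_univ _) (mem_univ _) ha hb hab

theorem modular_smul_le {c : ℝ} (hc : |c| ≤ 1) (f : Ω →ₘ[μ] ℝ) :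
    modular Φ μ (c • f) ≤ modular Φ μ f := by
  refine lintegral_mono_ae ?_
  filter_upwards [AEEqFun.coeFn_smul c f] with ω h
  rw [h, Pi.smul_apply, smul_eq_mul, abs_mul]
  refine ENNReal.ofReal_le_ofReal (Φ.mono (by positivity) ?_)
  exact mul_le_of_le_one_left (abs_nonneg _) hc

theorem modular_smul_add_le_one {a b : ℝ} (ha : 0 ≤ a) (hb : 0 ≤ b) (hab : a + b = 1)
    {f g : Ω →ₘ[μ] ℝ} (hf : modular Φ μ f ≤ 1) (hg : modular Φ μ g ≤ 1) :
    modular Φ μ (a • f + b • g) ≤ 1 := by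
  refine (modular_convex Φ ha hb hab f g).trans ?_
  calc ENNReal.ofReal a * modular Φ μ f + ENNReal.ofReal b * modular Φ μ g
      ≤ ENNReal.ofReal a * 1 + ENNReal.ofReal b * 1 := by gcongr
    _ = 1 := by rw [mul_one, mul_one, ← ENNReal.ofReal_add ha hb, hab, ENNReal.ofReal_one]

variable (μ)

/-- The Orlicz space `L^Φ(μ)`: the vector space of (classes of) measurable functions spanned by
its closed unit ball `{f | ∫ Φ(|f|) dμ ≤ 1}`. -/
noncomputable def orlicz : Submodule ℝ (Ω →ₘ[μ] ℝ) where
  carrier := {f | ∃ r : ℝ, 0 < r ∧ modular Φ μ (r⁻¹ • f) ≤ 1}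
  zero_mem' := ⟨1, one_pos, by simp [modular_zero]⟩
  add_mem' := by
    rintro f g ⟨r, hr, hf⟩ ⟨s, hs, hg⟩
    refine ⟨r + s, add_pos hr hs, ?_⟩
    have h := modular_smul_add_le_one Φ (a := r / (r + s)) (b := s / (r + s)) (by positivity)
      (by positivity) (by field_simp) hf hg
    rw [smul_smul, smul_smul] at h
    have e1 : r / (r + s) * r⁻¹ = (r + s)⁻¹ := by field_simp
    have e2 : s / (r + s) * s⁻¹ = (r + s)⁻¹ := by field_simp
    rwa [e1, e2, ← smul_add] at h
  smul_mem' := by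
    rintro c f ⟨r, hr, hf⟩
    refine ⟨r * (|c| + 1), by positivity, ?_⟩
    have e : (r * (|c| + 1))⁻¹ • c • f = (c / (|c| + 1)) • r⁻¹ • f := by
      rw [smul_smul, smul_smul]
      congr 1
      field_simp
    rw [e]
    refine (modular_smul_le Φ ?_ _).trans hf
    rw [abs_div, abs_of_pos (by positivity : 0 < |c| + 1), div_le_one (by positivity)]
    linarith

/-- The closed unit ball of `L^Φ(μ)`. -/
def orliczBall : Set (orlicz Φ μ) := {f | modular Φ μ (f : Ω →ₘ[μ] ℝ) ≤ 1}

theorem convex_orliczBall : Convex ℝ (orliczBall Φ μ) :=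
  fun _ hf _ hg _ _ ha hb hab => modular_smul_add_le_one Φ ha hb hab hf hg

theorem balanced_orliczBall : Balanced ℝ (orliczBall Φ μ) := by
  intro c hc
  rintro _ ⟨f, hf, rfl⟩
  exact (modular_smul_le Φ (by simpa using hc) _).trans hf

theorem absorbent_orliczBall : Absorbent ℝ (orliczBall Φ μ) := by
  intro f
  obtain ⟨r, hr, hf⟩ := f.2
  rw [absorbs_iff_norm]
  refine ⟨r, fun c hc => ?_⟩
  have hc0 : c ≠ 0 := by
    rintro rfl
    simp at hc
    linarith
  rw [singleton_subset_iff, mem_smul_set_iff_inv_smul_mem₀ hc0]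
  have e : c⁻¹ • (f : Ω →ₘ[μ] ℝ) = (r / c) • r⁻¹ • (f : Ω →ₘ[μ] ℝ) := by
    rw [smul_smul]
    congr 1
    field_simp
  change modular Φ μ (c⁻¹ • (f : Ω →ₘ[μ] ℝ)) ≤ 1
  rw [e]
  refine (modular_smul_le Φ ?_ _).trans hf
  rw [abs_div, abs_of_pos hr, div_le_one (abs_pos.2 hc0)]
  exact hc

/-- The Luxemburg norm of `L^Φ(μ)`, i.e. the gauge `inf {r > 0 | ∫ Φ(|f| / r) dμ ≤ 1}` of the
closed unit ball. -/
noncomputable def luxemburgNorm : Seminorm ℝ (orlicz Φ μ) :=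
  gaugeSeminorm (balanced_orliczBall Φ μ) (convex_orliczBall Φ μ) (absorbent_orliczBall Φ μ)

theorem luxemburgNorm_eq_sInf (f : orlicz Φ μ) :
    luxemburgNorm Φ μ f = sInf {r : ℝ | 0 < r ∧ modular Φ μ (r⁻¹ • (f : Ω →ₘ[μ] ℝ)) ≤ 1} :=
  gauge_def'

noncomputable instance : SeminormedAddCommGroup (orlicz Φ μ) :=
  (luxemburgNorm Φ μ).toAddGroupSeminorm.toSeminormedAddCommGroup

noncomputable instance : NormedSpace ℝ (orlicz Φ μ) where
  norm_smul_le c f := (map_smul_eq_mul (luxemburgNorm Φ μ) c f).le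

variable {μ}

theorem locallyIntegrable_of_mem_orlicz [TopologicalSpace Ω] [IsLocallyFiniteMeasure μ]
    {f : Ω →ₘ[μ] ℝ} (hf : f ∈ orlicz Φ μ) : LocallyIntegrable f μ := by
  obtain ⟨r, hr, hf⟩ := hf
  obtain ⟨a, b, ha, hb, hab⟩ := Φ.exists_abs_le
  intro x
  obtain ⟨U, hU, hμU⟩ := μ.finiteAt_nhds x
  refine ⟨U, hU, f.aestronglyMeasurable.restrict, ?_⟩
  have hle : ∀ᵐ ω ∂μ.restrict U, ‖f ω‖ₑ ≤ ENNReal.ofReal (r * a)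
      + ENNReal.ofReal (r * b) * ENNReal.ofReal (Φ |(r⁻¹ • f : Ω →ₘ[μ] ℝ) ω|) := by
    refine ae_restrict_of_ae ?_
    filter_upwards [AEEqFun.coeFn_smul r⁻¹ f] with ω h
    have hp := Φ.nonneg |(r⁻¹ • f : Ω →ₘ[μ] ℝ) ω|
    rw [← ENNReal.ofReal_mul (by positivity), ← ENNReal.ofReal_add (by positivity) (by positivity),
      ← ofReal_norm, Real.norm_eq_abs]
    refine ENNReal.ofReal_le_ofReal ?_
    have h1 := hab (r⁻¹ * f ω)
    rw [h, Φ.map_abs]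
    simp only [Pi.smul_apply, smul_eq_mul]
    rw [abs_mul, abs_of_pos (inv_pos.2 hr), inv_mul_le_iff₀ hr] at h1
    linarith
  refine (lintegral_mono_ae hle).trans_lt ?_
  rw [lintegral_add_left measurable_const, lintegral_const_mul' _ _ ENNReal.ofReal_ne_top,
    lintegral_const, Measure.restrict_apply_univ]
  refine ENNReal.add_lt_top.2 ⟨ENNReal.mul_lt_top ENNReal.ofReal_lt_top hμU,
    ENNReal.mul_lt_top ENNReal.ofReal_lt_top ?_⟩
  exact ((setLIntegral_le_lintegral _ _).trans hf).trans_lt ENNReal.one_lt_top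

end Orlicz

/-! ## The Gaussian Orlicz-Sobolev space -/

section Gauss

variable {n : ℕ}

/-- The standard Gaussian density on `ℝⁿ`. -/
noncomputable def gaussDensity (x : EuclideanSpace ℝ (Fin n)) : ℝ :=
  (2 * Real.pi) ^ (-(n : ℝ) / 2) * Real.exp (-‖x‖ ^ 2 / 2)

theorem continuous_gaussDensity : Continuous (gaussDensity (n := n)) := by
  unfold gaussDensity
  fun_prop

theorem gaussDensity_pos (x : EuclideanSpace ℝ (Fin n)) : 0 < gaussDensity x := by
  have := Real.pi_pos
  unfold gaussDensity
  positivity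

variable (n) in
/-- The standard Gaussian measure `γ(x) dx` on `ℝⁿ`. -/
noncomputable def gauss : Measure (EuclideanSpace ℝ (Fin n)) :=
  volume.withDensity fun x => ENNReal.ofReal (gaussDensity x)

instance : IsLocallyFiniteMeasure (gauss n) :=
  IsLocallyFiniteMeasure.withDensity_ofReal continuous_gaussDensity

theorem volume_absolutelyContinuous_gauss :
    (volume : Measure (EuclideanSpace ℝ (Fin n))) ≪ gauss n :=
  withDensity_absolutelyContinuous'
    (continuous_gaussDensity.measurable.ennreal_ofReal.aemeasurable)
    (Filter.Eventually.of_forall fun x => (ENNReal.ofReal_pos.2 (gaussDensity_pos x)).ne')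

/-- The classical partial derivative `∂ᵢ φ`. -/
noncomputable def partialDeriv (i : Fin n) (φ : EuclideanSpace ℝ (Fin n) → ℝ)
    (x : EuclideanSpace ℝ (Fin n)) : ℝ :=
  fderiv ℝ φ x (EuclideanSpace.single i 1)

/-- The Gaussian divergence `δᵢ φ (x) = xᵢ φ(x) - ∂ᵢ φ(x)`. -/
noncomputable def gaussDiv (i : Fin n) (φ : EuclideanSpace ℝ (Fin n) → ℝ)
    (x : EuclideanSpace ℝ (Fin n)) : ℝ :=
  x i * φ x - partialDeriv i φ x

theorem continuous_partialDeriv (i : Fin n) {φ : EuclideanSpace ℝ (Fin n) → ℝ}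
    (hφ : ContDiff ℝ 1 φ) : Continuous (partialDeriv i φ) :=
  (hφ.continuous_fderiv one_ne_zero).clm_apply continuous_const

theorem hasCompactSupport_partialDeriv (i : Fin n) {φ : EuclideanSpace ℝ (Fin n) → ℝ}
    (hφ : HasCompactSupport φ) : HasCompactSupport (partialDeriv i φ) :=
  hφ.fderiv_apply ℝ _

theorem continuous_gaussDiv (i : Fin n) {φ : EuclideanSpace ℝ (Fin n) → ℝ}
    (hφ : ContDiff ℝ 1 φ) : Continuous (gaussDiv i φ) := by
  have h1 := hφ.continuous
  have h2 := continuous_partialDeriv i hφ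
  unfold gaussDiv
  fun_prop

theorem hasCompactSupport_gaussDiv (i : Fin n) {φ : EuclideanSpace ℝ (Fin n) → ℝ}
    (hφ : HasCompactSupport φ) : HasCompactSupport (gaussDiv i φ) :=
  HasCompactSupport.sub (hφ.mul_left) (hasCompactSupport_partialDeriv i hφ)

/-- `g` is the weak partial derivative `∂ᵢ f` in the Gaussian space: `⟨g, φ⟩_γ = ⟨f, δᵢ φ⟩_γ` for
all compactly supported `φ` of class `C¹`. -/
def IsGaussWeakDeriv (i : Fin n) (f g : EuclideanSpace ℝ (Fin n) →ₘ[gauss n] ℝ) : Prop :=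
  ∀ φ : EuclideanSpace ℝ (Fin n) → ℝ, ContDiff ℝ 1 φ → HasCompactSupport φ →
    ∫ x, g x * φ x ∂gauss n = ∫ x, f x * gaussDiv i φ x ∂gauss n

/-- Pairing a locally integrable function with compactly supported continuous ones is linear. -/
theorem integral_linear {μ : Measure (EuclideanSpace ℝ (Fin n))} [IsLocallyFiniteMeasure μ]
    {f g h : EuclideanSpace ℝ (Fin n) → ℝ} (hf : LocallyIntegrable f μ)
    (hg : LocallyIntegrable g μ) {a b : ℝ} (hh : h =ᵐ[μ] fun x => a * f x + b * g x)
    {ψ : EuclideanSpace ℝ (Fin n) → ℝ} (hψ : Continuous ψ) (hc : HasCompactSupport ψ) :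
    ∫ x, h x * ψ x ∂μ = a * ∫ x, f x * ψ x ∂μ + b * ∫ x, g x * ψ x ∂μ := by
  have h1 : Integrable (fun x => f x * ψ x) μ := by
    simpa [mul_comm] using hf.integrable_smul_left_of_hasCompactSupport hψ hc
  have h2 : Integrable (fun x => g x * ψ x) μ := by
    simpa [mul_comm] using hg.integrable_smul_left_of_hasCompactSupport hψ hc
  rw [← integral_const_mul, ← integral_const_mul,
    ← integral_add (h1.const_mul a) (h2.const_mul b)]
  refine integral_congr_ae ?_
  filter_upwards [hh] with x hx
  rw [hx]
  ring

theorem coeFn_linear {α : Type*} [MeasurableSpace α] {μ : Measure α} (a b : ℝ) (f g : α →ₘ[μ] ℝ) :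
    ⇑(a • f + b • g) =ᵐ[μ] fun x => a * f x + b * g x := by
  filter_upwards [AEEqFun.coeFn_add (a • f) (b • g), AEEqFun.coeFn_smul a f,
    AEEqFun.coeFn_smul b g] with x h1 h2 h3
  rw [h1, Pi.add_apply, h2, h3]
  rfl

theorem IsGaussWeakDeriv.linear {i : Fin n} {f f' g g' : EuclideanSpace ℝ (Fin n) →ₘ[gauss n] ℝ}
    (hf : LocallyIntegrable f (gauss n)) (hf' : LocallyIntegrable f' (gauss n))
    (hg : LocallyIntegrable g (gauss n)) (hg' : LocallyIntegrable g' (gauss n))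
    (h : IsGaussWeakDeriv i f g) (h' : IsGaussWeakDeriv i f' g') (a b : ℝ) :
    IsGaussWeakDeriv i (a • f + b • f') (a • g + b • g') := by
  intro φ hφ hc
  rw [integral_linear hf hf' (coeFn_linear a b f f') (continuous_gaussDiv i hφ)
      (hasCompactSupport_gaussDiv i hc),
    integral_linear hg hg' (coeFn_linear a b g g') hφ.continuous hc, h φ hφ hc, h' φ hφ hc]

variable (n) in
/-- `L^{cosh₂}_1(γ)`, the sub-exponential random variables of the Gaussian space. -/
noncomputable abbrev SubExp : Submodule ℝ (EuclideanSpace ℝ (Fin n) →ₘ[gauss n] ℝ) :=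
  orlicz cosh₂ (gauss n)

variable (n) in
/-- `L^{cosh₂}_2(γ)`, the sub-Gaussian random variables of the Gaussian space: the Orlicz space of
the Young function `x ↦ cosh₂ (x ^ 2)`. -/
noncomputable abbrev SubGauss : Submodule ℝ (EuclideanSpace ℝ (Fin n) →ₘ[gauss n] ℝ) :=
  orlicz cosh₂.sq (gauss n)

variable (n) in
/-- The graph of the weak gradient from `L^{cosh₂}_1(γ)` to `L^{cosh₂}_2(γ)ⁿ`. -/
noncomputable def gaussGradGraph : Submodule ℝ (SubExp n × (Fin n → SubGauss n)) where
  carrier := {p | ∀ i, IsGaussWeakDeriv i (p.1 : EuclideanSpace ℝ (Fin n) →ₘ[gauss n] ℝ) (p.2 i)}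
  zero_mem' := by
    intro i φ _ _
    have h0 : ((0 : EuclideanSpace ℝ (Fin n) →ₘ[gauss n] ℝ) :
        EuclideanSpace ℝ (Fin n) → ℝ) =ᵐ[gauss n] 0 := AEEqFun.coeFn_zero
    have h1 : ∀ ψ : EuclideanSpace ℝ (Fin n) → ℝ,
        ∫ x, (0 : EuclideanSpace ℝ (Fin n) →ₘ[gauss n] ℝ) x * ψ x ∂gauss n = 0 := by
      intro ψ
      refine integral_eq_zero_of_ae ?_
      filter_upwards [h0] with x hx
      simp [hx]
    exact (h1 _).trans (h1 _).symm
  add_mem' := by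
    intro p q hp hq i
    have := (hp i).linear (locallyIntegrable_of_mem_orlicz _ p.1.2)
      (locallyIntegrable_of_mem_orlicz _ q.1.2) (locallyIntegrable_of_mem_orlicz _ (p.2 i).2)
      (locallyIntegrable_of_mem_orlicz _ (q.2 i).2) (hq i) 1 1
    simpa using this
  smul_mem' := by
    intro c p hp i
    have := (hp i).linear (locallyIntegrable_of_mem_orlicz _ p.1.2)
      (locallyIntegrable_of_mem_orlicz _ p.1.2) (locallyIntegrable_of_mem_orlicz _ (p.2 i).2)
      (locallyIntegrable_of_mem_orlicz _ (p.2 i).2) (hp i) c 0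
    simpa using this

/-- Uniqueness of the weak gradient. -/
theorem gaussGradGraph_unique (p : SubExp n × (Fin n → SubGauss n)) (hp : p ∈ gaussGradGraph n)
    (h0 : p.1 = 0) : p.2 = 0 := by
  funext i
  refine Subtype.ext (AEEqFun.ext ?_)
  have hz : ∀ᵐ x ∂gauss n, (p.2 i : EuclideanSpace ℝ (Fin n) →ₘ[gauss n] ℝ) x = 0 := by
    refine ae_eq_zero_of_integral_contDiff_smul_eq_zero
      (locallyIntegrable_of_mem_orlicz _ (p.2 i).2) fun φ hφ hc => ?_
    have h1 := hp i φ (hφ.of_le (by exact_mod_cast le_top)) hc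
    rw [h0] at h1
    have h2 : ∫ x, (0 : EuclideanSpace ℝ (Fin n) →ₘ[gauss n] ℝ) x * gaussDiv i φ x ∂gauss n
        = 0 := by
      refine integral_eq_zero_of_ae ?_
      filter_upwards [AEEqFun.coeFn_zero (μ := gauss n) (β := ℝ)] with x hx
      simp [hx]
    simp only [smul_eq_mul, mul_comm (φ _)]
    exact h1.trans h2
  filter_upwards [hz, AEEqFun.coeFn_zero (μ := gauss n) (β := ℝ)] with x hx hx'
  exact hx.trans hx'.symm

variable (n) in
/-- The weak gradient `∇`, an unbounded linear operator from `L^{cosh₂}_1(γ)` to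
`L^{cosh₂}_2(γ)ⁿ`. -/
noncomputable def gaussGrad : SubExp n →ₗ.[ℝ] (Fin n → SubGauss n) :=
  (gaussGradGraph n).toLinearPMap

variable (n) in
/-- `W¹L^{cosh₂}_{1,2}(γ)`: the `f ∈ L^{cosh₂}_1(γ)` with weak derivatives
`∂ᵢ f ∈ L^{cosh₂}_2(γ)`, `i = 1, …, n`. -/
def GaussSobolev : Type := (gaussGrad n).domain

theorem mem_gaussGrad_domain {f : SubExp n} : f ∈ (gaussGrad n).domain ↔
    ∀ i, ∃ g : SubGauss n,
      IsGaussWeakDeriv i (f : EuclideanSpace ℝ (Fin n) →ₘ[gauss n] ℝ) g := by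
  constructor
  · rintro ⟨p, hp, rfl⟩ i
    exact ⟨p.2 i, hp i⟩
  · intro h
    choose g hg using h
    exact ⟨(f, g), hg, rfl⟩

theorem gaussGrad_spec (f : (gaussGrad n).domain) (i : Fin n) :
    IsGaussWeakDeriv i ((f : SubExp n) : EuclideanSpace ℝ (Fin n) →ₘ[gauss n] ℝ)
      (gaussGrad n f i) :=
  Submodule.mem_graph_toLinearPMap gaussGradGraph_unique f i

namespace GaussSobolev

noncomputable instance : AddCommGroup (GaussSobolev n) := inferInstanceAs (AddCommGroup (gaussGrad n).domain)

noncomputable instance : Module ℝ (GaussSobolev n) := inferInstanceAs (Module ℝ (gaussGrad n).domain)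

variable (n) in
/-- The inclusion of `W¹L^{cosh₂}_{1,2}(γ)` in `L^{cosh₂}_1(γ)`. -/
noncomputable def toSubExp : GaussSobolev n →ₗ[ℝ] SubExp n := (gaussGrad n).domain.subtype

/-- The `i`-th weak partial derivative. -/
noncomputable def weakDeriv (i : Fin n) : GaussSobolev n →ₗ[ℝ] SubGauss n :=
  (LinearMap.proj i).comp (gaussGrad n).toFun

/-- The norm `‖f‖ + ∑ᵢ ‖∂ᵢ f‖` of `W¹L^{cosh₂}_{1,2}(γ)`. -/
noncomputable def sobolevNorm : Seminorm ℝ (GaussSobolev n) :=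
  (normSeminorm ℝ (SubExp n)).comp (toSubExp n)
    + ∑ i, (normSeminorm ℝ (SubGauss n)).comp (weakDeriv i)

noncomputable instance : SeminormedAddCommGroup (GaussSobolev n) :=
  sobolevNorm.toAddGroupSeminorm.toSeminormedAddCommGroup

noncomputable instance : NormedSpace ℝ (GaussSobolev n) where
  norm_smul_le c f := (map_smul_eq_mul sobolevNorm c f).le

theorem norm_eq (f : GaussSobolev n) : ‖f‖ = ‖toSubExp n f‖ + ∑ i, ‖weakDeriv i f‖ := by
  have h := congrFun (map_sum (FunLike.coeAddMonoidHom (Seminorm ℝ (GaussSobolev n)) (GaussSobolev n) ℝ)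
    (fun i => (normSeminorm ℝ (SubGauss n)).comp (weakDeriv i)) Finset.univ) f
  rw [Finset.sum_apply] at h
  exact congrArg (‖toSubExp n f‖ + ·) h

end GaussSobolev

end Gauss

/-! ## Sobolev and Hölder spaces on balls -/

section Ball

variable {n : ℕ}

/-- Lebesgue measure on the open ball `B_ρ` centred at the origin. -/
noncomputable abbrev ballMeasure (n : ℕ) (ρ : ℝ) : Measure (EuclideanSpace ℝ (Fin n)) :=
  volume.restrict (Metric.ball 0 ρ)

/-- `g` is the weak partial derivative `∂ᵢ f` on the open ball `B_ρ`. -/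
def IsBallWeakDeriv (ρ : ℝ) (i : Fin n) (f g : EuclideanSpace ℝ (Fin n) →ₘ[ballMeasure n ρ] ℝ) :
    Prop :=
  ∀ φ : EuclideanSpace ℝ (Fin n) → ℝ, ContDiff ℝ ((⊤ : ℕ∞) : WithTop ℕ∞) φ →
    HasCompactSupport φ → tsupport φ ⊆ Metric.ball 0 ρ →
    ∫ x in Metric.ball 0 ρ, g x * φ x = -∫ x in Metric.ball 0 ρ, f x * partialDeriv i φ x

theorem IsBallWeakDeriv.linear {ρ : ℝ} {i : Fin n}
    {f f' g g' : EuclideanSpace ℝ (Fin n) →ₘ[ballMeasure n ρ] ℝ}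
    (hf : LocallyIntegrable f (ballMeasure n ρ)) (hf' : LocallyIntegrable f' (ballMeasure n ρ))
    (hg : LocallyIntegrable g (ballMeasure n ρ)) (hg' : LocallyIntegrable g' (ballMeasure n ρ))
    (h : IsBallWeakDeriv ρ i f g) (h' : IsBallWeakDeriv ρ i f' g') (a b : ℝ) :
    IsBallWeakDeriv ρ i (a • f + b • f') (a • g + b • g') := by
  intro φ hφ hc hs
  have hφ1 : ContDiff ℝ 1 φ := hφ.of_le (by exact_mod_cast le_top)
  rw [integral_linear hf hf' (coeFn_linear a b f f') (continuous_partialDeriv i hφ1)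
      (hasCompactSupport_partialDeriv i hc),
    integral_linear hg hg' (coeFn_linear a b g g') hφ.continuous hc, h φ hφ hc hs, h' φ hφ hc hs]
  ring

variable (p : ℝ≥0∞) [hp : Fact (1 ≤ p)] (ρ : ℝ)

variable (n) in
/-- The graph of the weak gradient from `L^p(B_ρ)` to `L^p(B_ρ)ⁿ`. -/
noncomputable def ballGradGraph :
    Submodule ℝ (Lp ℝ p (ballMeasure n ρ) × (Fin n → Lp ℝ p (ballMeasure n ρ))) where
  carrier := {u | ∀ i, IsBallWeakDeriv ρ i
    (u.1 : EuclideanSpace ℝ (Fin n) →ₘ[ballMeasure n ρ] ℝ) (u.2 i)}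
  zero_mem' := by
    intro i φ _ _ _
    have h1 : ∀ ψ : EuclideanSpace ℝ (Fin n) → ℝ,
        ∫ x in Metric.ball 0 ρ, (0 : EuclideanSpace ℝ (Fin n) →ₘ[ballMeasure n ρ] ℝ) x * ψ x
          = 0 := by
      intro ψ
      refine integral_eq_zero_of_ae ?_
      filter_upwards [AEEqFun.coeFn_zero (μ := ballMeasure n ρ) (β := ℝ)] with x hx
      simp [hx]
    exact (h1 _).trans (neg_eq_zero.2 (h1 _)).symm
  add_mem' := by
    intro u v hu hv i
    have := (hu i).linear ((Lp.memLp u.1).locallyIntegrable hp.out)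
      ((Lp.memLp v.1).locallyIntegrable hp.out) ((Lp.memLp (u.2 i)).locallyIntegrable hp.out)
      ((Lp.memLp (v.2 i)).locallyIntegrable hp.out) (hv i) 1 1
    simpa using this
  smul_mem' := by
    intro c u hu i
    have := (hu i).linear ((Lp.memLp u.1).locallyIntegrable hp.out)
      ((Lp.memLp u.1).locallyIntegrable hp.out) ((Lp.memLp (u.2 i)).locallyIntegrable hp.out)
      ((Lp.memLp (u.2 i)).locallyIntegrable hp.out) (hu i) c 0
    rw [zero_smul, zero_smul, add_zero, add_zero] at this
    exact this

/-- Uniqueness of the weak gradient. -/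
theorem ballGradGraph_unique
    (u : Lp ℝ p (ballMeasure n ρ) × (Fin n → Lp ℝ p (ballMeasure n ρ)))
    (hu : u ∈ ballGradGraph n p ρ) (h0 : u.1 = 0) : u.2 = 0 := by
  funext i
  refine Subtype.ext (AEEqFun.ext ?_)
  have hz : ∀ᵐ x ∂(volume : Measure (EuclideanSpace ℝ (Fin n))),
      x ∈ Metric.ball 0 ρ → (u.2 i : EuclideanSpace ℝ (Fin n) → ℝ) x = 0 := by
    refine Metric.isOpen_ball.ae_eq_zero_of_integral_contDiff_smul_eq_zero
      (locallyIntegrableOn_of_locallyIntegrable_restrict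
        ((Lp.memLp (u.2 i)).locallyIntegrable hp.out)) fun φ hφ hc hs => ?_
    have h1 := hu i φ hφ hc hs
    rw [h0] at h1
    have h2 : ∫ x in Metric.ball 0 ρ, ((0 : Lp ℝ p (ballMeasure n ρ)) :
        EuclideanSpace ℝ (Fin n) →ₘ[ballMeasure n ρ] ℝ) x * partialDeriv i φ x = 0 := by
      refine integral_eq_zero_of_ae ?_
      filter_upwards [Lp.coeFn_zero ℝ p (ballMeasure n ρ)] with x hx
      rw [hx, Pi.zero_apply, zero_mul]
    rw [h2, neg_zero] at h1
    rw [← h1, ← setIntegral_eq_integral_of_forall_compl_eq_zero (s := Metric.ball 0 ρ)]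
    · simp only [smul_eq_mul, mul_comm (φ _)]
    · intro x hx
      rw [image_eq_zero_of_notMem_tsupport (fun h => hx (hs h)), zero_smul]
  have hz' := (ae_restrict_iff' Metric.isOpen_ball.measurableSet).2 hz
  filter_upwards [hz', Lp.coeFn_zero ℝ p (ballMeasure n ρ)] with x hx hx'
  exact hx.trans hx'.symm

variable (n) in
/-- The weak gradient as an unbounded linear operator from `L^p(B_ρ)` to `L^p(B_ρ)ⁿ`. -/
noncomputable def ballGrad :
    Lp ℝ p (ballMeasure n ρ) →ₗ.[ℝ] (Fin n → Lp ℝ p (ballMeasure n ρ)) :=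
  (ballGradGraph n p ρ).toLinearPMap

variable (n) in
/-- The Sobolev space `W^{1,p}(B_ρ)`: the `f ∈ L^p(B_ρ)` with weak derivatives
`∂ᵢ f ∈ L^p(B_ρ)`, `i = 1, …, n`. -/
def BallSobolev : Type := (ballGrad n p ρ).domain

variable {p ρ}

theorem mem_ballGrad_domain {f : Lp ℝ p (ballMeasure n ρ)} : f ∈ (ballGrad n p ρ).domain ↔
    ∀ i, ∃ g : Lp ℝ p (ballMeasure n ρ),
      IsBallWeakDeriv ρ i (f : EuclideanSpace ℝ (Fin n) →ₘ[ballMeasure n ρ] ℝ) g := by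
  constructor
  · rintro ⟨u, hu, rfl⟩ i
    exact ⟨u.2 i, hu i⟩
  · intro h
    choose g hg using h
    exact ⟨(f, g), hg, rfl⟩

theorem ballGrad_spec (f : (ballGrad n p ρ).domain) (i : Fin n) :
    IsBallWeakDeriv ρ i
      ((f : Lp ℝ p (ballMeasure n ρ)) : EuclideanSpace ℝ (Fin n) →ₘ[ballMeasure n ρ] ℝ)
      (ballGrad n p ρ f i) :=
  Submodule.mem_graph_toLinearPMap (ballGradGraph_unique p ρ) f i

namespace BallSobolev

noncomputable instance : AddCommGroup (BallSobolev n p ρ) :=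
  inferInstanceAs (AddCommGroup (ballGrad n p ρ).domain)

noncomputable instance : Module ℝ (BallSobolev n p ρ) :=
  inferInstanceAs (Module ℝ (ballGrad n p ρ).domain)

/-- The inclusion of `W^{1,p}(B_ρ)` in `L^p(B_ρ)`. -/
noncomputable def toLp : BallSobolev n p ρ →ₗ[ℝ] Lp ℝ p (ballMeasure n ρ) :=
  (ballGrad n p ρ).domain.subtype

/-- The `i`-th weak partial derivative. -/
noncomputable def weakDeriv (i : Fin n) : BallSobolev n p ρ →ₗ[ℝ] Lp ℝ p (ballMeasure n ρ) :=
  (LinearMap.proj i).comp (ballGrad n p ρ).toFun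

/-- The norm `‖f‖ + ∑ᵢ ‖∂ᵢ f‖` of `W^{1,p}(B_ρ)`. -/
noncomputable def sobolevNorm : Seminorm ℝ (BallSobolev n p ρ) :=
  (normSeminorm ℝ (Lp ℝ p (ballMeasure n ρ))).comp toLp
    + ∑ i, (normSeminorm ℝ (Lp ℝ p (ballMeasure n ρ))).comp (weakDeriv i)

noncomputable instance : SeminormedAddCommGroup (BallSobolev n p ρ) :=
  sobolevNorm.toAddGroupSeminorm.toSeminormedAddCommGroup

noncomputable instance : NormedSpace ℝ (BallSobolev n p ρ) where
  norm_smul_le c f := (map_smul_eq_mul sobolevNorm c f).le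

theorem norm_eq (f : BallSobolev n p ρ) : ‖f‖ = ‖toLp f‖ + ∑ i, ‖weakDeriv i f‖ := by
  have h := congrFun (map_sum (FunLike.coeAddMonoidHom (Seminorm ℝ (BallSobolev n p ρ)) (BallSobolev n p ρ) ℝ)
    (fun i => (normSeminorm ℝ (Lp ℝ p (ballMeasure n ρ))).comp (weakDeriv i)) Finset.univ) f
  rw [Finset.sum_apply] at h
  exact congrArg (‖toLp f‖ + ·) h

end BallSobolev

end Ball

section Holder

variable (n : ℕ) (lam : ℝ≥0) (ρ : ℝ)

/-- The `lam`-Hölder functions on the closed ball of radius `ρ` centred at the origin, as a space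
of continuous functions. -/
noncomputable def holderSubmodule :
    Submodule ℝ C(Metric.closedBall (0 : EuclideanSpace ℝ (Fin n)) ρ, ℝ) where
  carrier := {u | MemHolder lam u}
  zero_mem' := memHolder_zero
  add_mem' hu hv := hu.add hv
  smul_mem' c _ hu := MemHolder.smul (c := c) hu

/-- The Hölder space `C^lam` of the closed ball of radius `ρ` centred at the origin. -/
def BallHolder : Type := holderSubmodule n lam ρ

variable {n lam ρ}

namespace BallHolder

noncomputable instance : AddCommGroup (BallHolder n lam ρ) :=
  inferInstanceAs (AddCommGroup (holderSubmodule n lam ρ))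

noncomputable instance : Module ℝ (BallHolder n lam ρ) :=
  inferInstanceAs (Module ℝ (holderSubmodule n lam ρ))

/-- The underlying continuous function. -/
noncomputable def toContinuousMap :
    BallHolder n lam ρ →ₗ[ℝ] C(Metric.closedBall (0 : EuclideanSpace ℝ (Fin n)) ρ, ℝ) :=
  (holderSubmodule n lam ρ).subtype

theorem memHolder (u : BallHolder n lam ρ) : MemHolder lam (toContinuousMap u) :=
  Subtype.property (p := (· ∈ holderSubmodule n lam ρ)) u

/-- The Hölder norm `sup |u| + sup_{x ≠ y} |u x - u y| / |x - y| ^ lam`. -/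
noncomputable def holderNorm : Seminorm ℝ (BallHolder n lam ρ) :=
  (normSeminorm ℝ C(Metric.closedBall (0 : EuclideanSpace ℝ (Fin n)) ρ, ℝ)).comp toContinuousMap
    + Seminorm.of (fun u => (nnHolderNorm lam (toContinuousMap u) : ℝ))
      (fun u v => by exact_mod_cast (memHolder u).nnHolderNorm_add_le (memHolder v))
      (fun c u => by
        have h := (memHolder u).nnHolderNorm_smul c
        have h' := congrArg ((↑) : ℝ≥0 → ℝ) h
        simpa using h')

noncomputable instance : SeminormedAddCommGroup (BallHolder n lam ρ) :=
  holderNorm.toAddGroupSeminorm.toSeminormedAddCommGroup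

noncomputable instance : NormedSpace ℝ (BallHolder n lam ρ) where
  norm_smul_le c f := (map_smul_eq_mul holderNorm c f).le

theorem norm_eq (u : BallHolder n lam ρ) :
    ‖u‖ = ‖toContinuousMap u‖ + nnHolderNorm lam (toContinuousMap u) := rfl

end BallHolder

end Holder

/-! ## The intersection spaces on `ℝⁿ` -/

section Inter

variable {n : ℕ}

/-- Restriction of (classes of) measurable functions on `ℝⁿ` to the ball `B_ρ`. -/
noncomputable def restrictBall (ρ : ℝ) (f : EuclideanSpace ℝ (Fin n) →ₘ[gauss n] ℝ) :
    EuclideanSpace ℝ (Fin n) →ₘ[ballMeasure n ρ] ℝ :=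
  AEEqFun.mk f (f.aestronglyMeasurable.mono_ac
    (Measure.absolutelyContinuous_of_le Measure.restrict_le_self |>.trans
      volume_absolutelyContinuous_gauss))

theorem coeFn_restrictBall (ρ : ℝ) (f : EuclideanSpace ℝ (Fin n) →ₘ[gauss n] ℝ) :
    restrictBall ρ f =ᵐ[ballMeasure n ρ] f :=
  AEEqFun.coeFn_mk _ _

theorem restrictBall_add (ρ : ℝ) (f g : EuclideanSpace ℝ (Fin n) →ₘ[gauss n] ℝ) :
    restrictBall ρ (f + g) = restrictBall ρ f + restrictBall ρ g := by
  refine AEEqFun.ext ?_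
  have hac : ballMeasure n ρ ≪ gauss n :=
    (Measure.absolutelyContinuous_of_le Measure.restrict_le_self).trans
      volume_absolutelyContinuous_gauss
  filter_upwards [coeFn_restrictBall ρ f, coeFn_restrictBall ρ g, coeFn_restrictBall ρ (f + g),
    AEEqFun.coeFn_add (restrictBall ρ f) (restrictBall ρ g),
    hac.ae_le (AEEqFun.coeFn_add f g)] with x h1 h2 h3 h4 h5
  rw [h3, h4, h5, Pi.add_apply, Pi.add_apply, h1, h2]

theorem restrictBall_smul (ρ : ℝ) (c : ℝ) (f : EuclideanSpace ℝ (Fin n) →ₘ[gauss n] ℝ) :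
    restrictBall ρ (c • f) = c • restrictBall ρ f := by
  refine AEEqFun.ext ?_
  have hac : ballMeasure n ρ ≪ gauss n :=
    (Measure.absolutelyContinuous_of_le Measure.restrict_le_self).trans
      volume_absolutelyContinuous_gauss
  filter_upwards [coeFn_restrictBall ρ f, coeFn_restrictBall ρ (c • f),
    AEEqFun.coeFn_smul c (restrictBall ρ f), hac.ae_le (AEEqFun.coeFn_smul c f)] with x h1 h2 h3 h4
  rw [h2, h3, h4, Pi.smul_apply, Pi.smul_apply, h1]

/-- The `f ∈ L^{cosh₂}_1(γ)` whose restriction to `B_ρ` belongs to `W^{1,p}(B_ρ)` for all `ρ > 0`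
and all finite `p ≥ 1`. -/
noncomputable def locSobolevSubmodule (n : ℕ) : Submodule ℝ (SubExp n) where
  carrier := {f | ∀ (p : ℝ≥0∞) [Fact (1 ≤ p)], p ≠ ⊤ → ∀ ρ : ℝ, 0 < ρ →
    ∃ u : BallSobolev n p ρ, (BallSobolev.toLp u : EuclideanSpace ℝ (Fin n) →ₘ[ballMeasure n ρ] ℝ)
      = restrictBall ρ (f : EuclideanSpace ℝ (Fin n) →ₘ[gauss n] ℝ)}
  zero_mem' := by
    intro p _ _ ρ _
    refine ⟨0, ?_⟩
    have h := restrictBall_smul ρ 0 (0 : EuclideanSpace ℝ (Fin n) →ₘ[gauss n] ℝ)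
    rw [zero_smul, zero_smul] at h
    rw [map_zero]
    exact h.symm
  add_mem' := by
    intro f g hf hg p _ hp ρ hρ
    obtain ⟨u, hu⟩ := hf p hp ρ hρ
    obtain ⟨v, hv⟩ := hg p hp ρ hρ
    refine ⟨u + v, ?_⟩
    rw [map_add, AddSubgroup.coe_add, hu, hv]
    exact (restrictBall_add ρ _ _).symm
  smul_mem' := by
    intro c f hf p _ hp ρ hρ
    obtain ⟨u, hu⟩ := hf p hp ρ hρ
    refine ⟨c • u, ?_⟩
    rw [map_smul]
    change c • (BallSobolev.toLp u : EuclideanSpace ℝ (Fin n) →ₘ[ballMeasure n ρ] ℝ) = _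
    rw [hu]
    exact (restrictBall_smul ρ c _).symm

/-- The space `⋂_{1 ≤ p < ∞} W^{1,p}_loc ∩ L^{cosh₂}_1(γ)`. -/
def LocSobolevSubExp (n : ℕ) : Type := locSobolevSubmodule n

namespace LocSobolevSubExp

noncomputable instance : AddCommGroup (LocSobolevSubExp n) :=
  inferInstanceAs (AddCommGroup (locSobolevSubmodule n))

noncomputable instance : Module ℝ (LocSobolevSubExp n) :=
  inferInstanceAs (Module ℝ (locSobolevSubmodule n))

variable (n) in
/-- The inclusion in `L^{cosh₂}_1(γ)`. -/
noncomputable def toSubExp : LocSobolevSubExp n →ₗ[ℝ] SubExp n := (locSobolevSubmodule n).subtype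

theorem exists_restrict (f : LocSobolevSubExp n) (p : ℝ≥0∞) [Fact (1 ≤ p)] (hp : p ≠ ⊤) (ρ : ℝ)
    (hρ : 0 < ρ) : ∃ u : BallSobolev n p ρ,
      (BallSobolev.toLp u : EuclideanSpace ℝ (Fin n) →ₘ[ballMeasure n ρ] ℝ)
        = restrictBall ρ (toSubExp n f : EuclideanSpace ℝ (Fin n) →ₘ[gauss n] ℝ) :=
  Subtype.property (p := (· ∈ locSobolevSubmodule n)) f p hp ρ hρ

/-- The restriction to `B_ρ`, as an element of `W^{1,p}(B_ρ)`. -/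
noncomputable def restrict (p : ℝ≥0∞) [Fact (1 ≤ p)] (hp : p ≠ ⊤) (ρ : ℝ) (hρ : 0 < ρ)
    (f : LocSobolevSubExp n) : BallSobolev n p ρ :=
  (exists_restrict f p hp ρ hρ).choose

theorem toLp_restrict (p : ℝ≥0∞) [Fact (1 ≤ p)] (hp : p ≠ ⊤) (ρ : ℝ) (hρ : 0 < ρ)
    (f : LocSobolevSubExp n) :
    (BallSobolev.toLp (restrict p hp ρ hρ f) :
        EuclideanSpace ℝ (Fin n) →ₘ[ballMeasure n ρ] ℝ)
      = restrictBall ρ (toSubExp n f : EuclideanSpace ℝ (Fin n) →ₘ[gauss n] ℝ) :=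
  (exists_restrict f p hp ρ hρ).choose_spec

/-- The intersection topology: the coarsest one for which the inclusion in `L^{cosh₂}_1(γ)` and all
the restrictions to `W^{1,p}(B_ρ)`, `1 ≤ p < ∞`, `ρ > 0`, are continuous. -/
noncomputable instance : TopologicalSpace (LocSobolevSubExp n) :=
  TopologicalSpace.induced (toSubExp n) inferInstance ⊓
    ⨅ (p : ℝ≥0∞) (_ : Fact (1 ≤ p)) (hp : p ≠ ⊤) (ρ : ℝ) (hρ : 0 < ρ),
      TopologicalSpace.induced (restrict p hp ρ hρ) inferInstance

end LocSobolevSubExp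

/-- The space `C(ℝⁿ) ∩ L^{cosh₂}_1(γ)` of continuous functions whose class is in
`L^{cosh₂}_1(γ)`. -/
def ContinuousSubExp (n : ℕ) : Type :=
  (SubExp n).comap (ContinuousMap.toAEEqFunLinearMap (α := EuclideanSpace ℝ (Fin n)) (γ := ℝ)
    (𝕜 := ℝ) (gauss n))

namespace ContinuousSubExp

noncomputable instance : AddCommGroup (ContinuousSubExp n) :=
  inferInstanceAs (AddCommGroup ((SubExp n).comap (ContinuousMap.toAEEqFunLinearMap
    (α := EuclideanSpace ℝ (Fin n)) (γ := ℝ) (𝕜 := ℝ) (gauss n))))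

noncomputable instance : Module ℝ (ContinuousSubExp n) :=
  inferInstanceAs (Module ℝ ((SubExp n).comap (ContinuousMap.toAEEqFunLinearMap
    (α := EuclideanSpace ℝ (Fin n)) (γ := ℝ) (𝕜 := ℝ) (gauss n))))

variable (n) in
/-- The inclusion in `C(ℝⁿ)`. -/
noncomputable def toContinuousMap :
    ContinuousSubExp n →ₗ[ℝ] C(EuclideanSpace ℝ (Fin n), ℝ) :=
  ((SubExp n).comap (ContinuousMap.toAEEqFunLinearMap
    (α := EuclideanSpace ℝ (Fin n)) (γ := ℝ) (𝕜 := ℝ) (gauss n))).subtype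

variable (n) in
/-- The inclusion in `L^{cosh₂}_1(γ)`. -/
noncomputable def toSubExp : ContinuousSubExp n →ₗ[ℝ] SubExp n :=
  ((ContinuousMap.toAEEqFunLinearMap (gauss n)).comp (toContinuousMap n)).codRestrict (SubExp n)
    fun g => Subtype.property (p := (· ∈ (SubExp n).comap (ContinuousMap.toAEEqFunLinearMap
      (α := EuclideanSpace ℝ (Fin n)) (γ := ℝ) (𝕜 := ℝ) (gauss n)))) g

theorem coeFn_toSubExp (g : ContinuousSubExp n) :
    (toSubExp n g : EuclideanSpace ℝ (Fin n) →ₘ[gauss n] ℝ) =ᵐ[gauss n] toContinuousMap n g :=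
  ContinuousMap.coeFn_toAEEqFun _ _

/-- The intersection topology: the coarsest one for which the inclusions in `C(ℝⁿ)` (with uniform
convergence on compact sets, i.e. the compact-open topology) and in `L^{cosh₂}_1(γ)` are
continuous. -/
noncomputable instance : TopologicalSpace (ContinuousSubExp n) :=
  TopologicalSpace.induced (toContinuousMap n) inferInstance ⊓
    TopologicalSpace.induced (toSubExp n) inferInstance

end ContinuousSubExp

end Inter

end OrliczSobolev

open OrliczSobolev

/-! ## Morrey's inequality for functions of class `C¹` on a bounded convex set -/

section Morrey

variable {E : Type*} [NormedAddCommGroup E] [NormedSpace ℝ E]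

/-! Local bounds. On `B_ρ` the Gaussian density is bounded below by a positive constant, so Lebesgue
measure on the ball is at most a multiple of `γ`. Since `cosh₂ x` and `cosh₂ (x ^ 2)` grow faster
than every power, both Orlicz spaces restrict boundedly to `L^α(B_ρ)` for each finite `α`
(`exists_restrictLp`). Gaussian weak derivatives are ordinary ones: as `∂ᵢγ = -xᵢγ`, testing with
`ψ/γ` gives `γ · δᵢ(ψ/γ) = -∂ᵢψ` (`IsGaussWeakDeriv.isBallWeakDeriv`).

Hölder regularity. For `v` of class `C¹` on a bounded convex `D`, compare `v x` and `v y` with the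
averages of `v` over the images of `D` under the homotheties of ratio `t` centred at `x` and `y`. A
homothety of ratio `s` costs a Jacobian factor `s^(-n)`, which Hölder's inequality reduces to
`s^(-n/p) ≤ s^(λ-1)`; this is integrable at `0`, also in the borderline case `n/p = 1 - λ`. The
choice `t = |x - y|/d` balances all terms (`enorm_sub_le_of_contDiff`). Mollification on smaller
balls carries the estimate to `W^{1,p}(B_ρ)` on a set of full measure, with a constant independent
of the smaller ball (`BallSobolev.exists_holderOnWith`); a Hölder extension then provides values on
the whole closed ball.

Globalisation. Taking `p = 2n` and `λ = 1/2` on the balls of integer radius gives continuous pieces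
that agree a.e. with one function, hence agree on overlaps and glue. A compact set lies in some such
ball, so the estimates on balls give continuity into the compact-open topology. All the maps
preserve the a.e. class, and a continuous function is determined by its class; linearity and
injectivity follow. -/

theorem Convex.homothety_mem {D : Set E} (hD : Convex ℝ D) {w z : E} (hw : w ∈ D) (hz : z ∈ D)
    {s : ℝ} (hs0 : 0 ≤ s) (hs1 : s ≤ 1) : w + s • (z - w) ∈ D :=
  hD.add_smul_sub_mem hw hz ⟨hs0, hs1⟩

theorem enorm_sub_le_lintegral_fderiv {F : Type*} [NormedAddCommGroup F] [NormedSpace ℝ F]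
    [CompleteSpace F] {v : E → F} (hv : ContDiff ℝ 1 v) (a b : E) {t : ℝ} (ht : 0 ≤ t) :
    ‖v (a + t • b) - v a‖ₑ ≤ ∫⁻ s in Ioc 0 t, ‖fderiv ℝ v (a + s • b)‖ₑ * ‖b‖ₑ := by
  have hc : Continuous fun s : ℝ => fderiv ℝ v (a + s • b) b :=
    ((hv.continuous_fderiv one_ne_zero).comp (by fun_prop)).clm_apply continuous_const
  have hd : ∀ s ∈ uIcc 0 t,
      HasDerivAt (fun s : ℝ => v (a + s • b)) (fderiv ℝ v (a + s • b) b) s := by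
    intro s _
    have h1 : HasDerivAt (fun s : ℝ => a + s • b) b s := by
      simpa using ((hasDerivAt_id s).smul_const b).const_add a
    exact ((hv.differentiable one_ne_zero).differentiableAt.hasFDerivAt).comp_hasDerivAt s h1
  have h := intervalIntegral.integral_eq_sub_of_hasDerivAt hd (hc.intervalIntegrable _ _)
  rw [zero_smul, add_zero, intervalIntegral.integral_of_le ht] at h
  rw [← h]
  refine (enorm_integral_le_lintegral_enorm _).trans (lintegral_mono fun s => ?_)
  exact ContinuousLinearMap.le_opENorm _ _

variable [FiniteDimensional ℝ E] [MeasurableSpace E] [BorelSpace E] (μ : Measure E)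
  [μ.IsAddHaarMeasure]

theorem lintegral_comp_smul_of_pos {f : E → ℝ≥0∞} {s : ℝ} (hs : 0 < s) :
    ∫⁻ z, f (s • z) ∂μ = ENNReal.ofReal ((s ^ Module.finrank ℝ E)⁻¹) * ∫⁻ z, f z ∂μ := by
  have h := (Homeomorph.smulOfNeZero s hs.ne').measurableEmbedding.lintegral_map (μ := μ) f
  have h2 := Measure.map_addHaar_smul μ hs.ne'
  rw [abs_of_pos (by positivity)] at h2
  change ∫⁻ z, f z ∂(Measure.map (fun x => s • x) μ) = ∫⁻ z, f (s • z) ∂μ at h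
  rw [← h, h2, lintegral_smul_measure, smul_eq_mul]

/-- By convexity the contraction towards `w` keeps `D` inside `D`, so extending `f` by zero loses
nothing, and the change of variables costs only the Jacobian. -/
theorem setLIntegral_homothety_le {D : Set E} (hD : Convex ℝ D) (hDm : MeasurableSet D)
    (f : E → ℝ≥0∞) {w : E} (hw : w ∈ D) {s : ℝ} (hs : 0 < s) (hs1 : s ≤ 1) :
    ∫⁻ z in D, f (w + s • (z - w)) ∂μ
      ≤ ENNReal.ofReal ((s ^ Module.finrank ℝ E)⁻¹) * ∫⁻ z in D, f z ∂μ := by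
  calc ∫⁻ z in D, f (w + s • (z - w)) ∂μ
      ≤ ∫⁻ z, D.indicator f (w + s • (z - w)) ∂μ := by
        rw [← lintegral_indicator hDm]
        refine lintegral_mono fun z => ?_
        by_cases hz : z ∈ D
        · rw [indicator_of_mem hz, indicator_of_mem (hD.homothety_mem hw hz hs.le hs1)]
        · simp [hz]
    _ = ∫⁻ z, D.indicator f (w + s • z) ∂μ :=
        lintegral_sub_right_eq_self (fun z => D.indicator f (w + s • z)) w
    _ = ENNReal.ofReal ((s ^ Module.finrank ℝ E)⁻¹) * ∫⁻ z, D.indicator f (w + z) ∂μ :=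
        lintegral_comp_smul_of_pos μ (f := fun z => D.indicator f (w + z)) hs
    _ = _ := by
        rw [lintegral_add_left_eq_self (D.indicator f) w, lintegral_indicator hDm]

/-- Hölder's inequality on `D`, then the Jacobian bound for `f ^ p`: the factor `s^(-n)` becomes
`s^(-n/p)`, at most `s^(lam - 1)` because `s ≤ 1`. No strict inequality between exponents is needed.
-/
theorem setLIntegral_homothety_le_rpow {D : Set E} (hD : Convex ℝ D) (hDm : MeasurableSet D)
    {f : E → ℝ≥0∞} (hf : Measurable f) {p lam : ℝ} (hp : 1 ≤ p)
    (hlam : Module.finrank ℝ E / p ≤ 1 - lam) {w : E} (hw : w ∈ D) {s : ℝ} (hs : 0 < s)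
    (hs1 : s ≤ 1) :
    ∫⁻ z in D, f (w + s • (z - w)) ∂μ
      ≤ ENNReal.ofReal (s ^ (lam - 1)) *
        ((∫⁻ z in D, f z ^ p ∂μ) ^ (1 / p) * μ D ^ (1 - 1 / p)) := by
  have hp0 : 0 < p := by linarith
  have h1 := eLpNorm'_le_eLpNorm'_mul_rpow_measure_univ (μ := μ.restrict D)
    (f := fun z => f (w + s • (z - w))) one_pos hp
    (hf.comp (by fun_prop)).aestronglyMeasurable
  simp only [eLpNorm'_eq_lintegral_enorm, enorm_eq_self, ENNReal.rpow_one, div_one,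
    Measure.restrict_apply_univ] at h1
  have h2 := setLIntegral_homothety_le μ hD hDm (fun z => f z ^ p) hw hs hs1
  refine h1.trans ?_
  rw [← mul_assoc]
  gcongr
  refine (ENNReal.rpow_le_rpow h2 (by positivity : 0 ≤ 1 / p)).trans ?_
  rw [ENNReal.mul_rpow_of_nonneg _ _ (by positivity)]
  gcongr
  rw [ENNReal.ofReal_rpow_of_pos (by positivity)]
  refine ENNReal.ofReal_le_ofReal ?_
  rw [← Real.rpow_natCast, ← Real.rpow_neg hs.le, ← Real.rpow_mul hs.le]
  refine Real.rpow_le_rpow_of_exponent_ge hs hs1 ?_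
  have : -(Module.finrank ℝ E : ℝ) * (1 / p) = -(Module.finrank ℝ E / p) := by ring
  rw [this]
  linarith

theorem lintegral_Ioc_rpow {lam t : ℝ} (hlam : 0 < lam) (ht : 0 ≤ t) :
    ∫⁻ s in Ioc 0 t, ENNReal.ofReal (s ^ (lam - 1)) = ENNReal.ofReal (t ^ lam / lam) := by
  have hi : IntervalIntegrable (fun s : ℝ => s ^ (lam - 1)) volume 0 t :=
    intervalIntegral.intervalIntegrable_rpow' (by linarith)
  rw [← ofReal_integral_eq_lintegral_ofReal ((intervalIntegrable_iff_integrableOn_Ioc_of_le ht).1 hi),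
    ← intervalIntegral.integral_of_le ht, integral_rpow (Or.inl (by linarith))]
  · simp [Real.zero_rpow hlam.ne']
  · filter_upwards [ae_restrict_mem measurableSet_Ioc] with s hs
    exact Real.rpow_nonneg hs.1.le _

/-- First leg of Morrey's comparison: from the centre `x` to the shrunken copy of `D`. Integrate the
gradient along the segment, exchange integrals, and use that `s^(lam - 1)` has integral `t^lam /
lam` over `(0, t]`. -/
theorem setLIntegral_sub_homothety_le {v : E → ℝ} (hv : ContDiff ℝ 1 v)
    {D : Set E} (hD : Convex ℝ D) (hDm : MeasurableSet D) {d : ℝ}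
    (hd : ∀ x ∈ D, ∀ y ∈ D, ‖x - y‖ ≤ d) {p lam : ℝ} (hp : 1 ≤ p) (hlam0 : 0 < lam)
    (hlam : Module.finrank ℝ E / p ≤ 1 - lam) {x : E} (hx : x ∈ D) {t : ℝ} (ht : 0 ≤ t)
    (ht1 : t ≤ 1) :
    ∫⁻ z in D, ‖v (x + t • (z - x)) - v x‖ₑ ∂μ ≤ ENNReal.ofReal (d * t ^ lam / lam) *
        ((∫⁻ z in D, ‖fderiv ℝ v z‖ₑ ^ p ∂μ) ^ (1 / p) * μ D ^ (1 - 1 / p)) := by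
  have hd0 : 0 ≤ d := (norm_nonneg _).trans (hd x hx x hx)
  have hc : Continuous (fderiv ℝ v) := hv.continuous_fderiv one_ne_zero
  set A := (∫⁻ z in D, ‖fderiv ℝ v z‖ₑ ^ p ∂μ) ^ (1 / p) * μ D ^ (1 - 1 / p)
  have hm : Measurable (fun q : E × ℝ => ‖fderiv ℝ v (x + q.2 • (q.1 - x))‖ₑ) :=
    (hc.comp (by fun_prop)).enorm.measurable
  calc ∫⁻ z in D, ‖v (x + t • (z - x)) - v x‖ₑ ∂μ
      ≤ ∫⁻ z in D, (∫⁻ s in Ioc 0 t,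
          ENNReal.ofReal d * ‖fderiv ℝ v (x + s • (z - x))‖ₑ) ∂μ := by
        refine setLIntegral_mono' hDm fun z hz => ?_
        refine (enorm_sub_le_lintegral_fderiv hv x (z - x) ht).trans (lintegral_mono fun s => ?_)
        rw [mul_comm]
        gcongr
        rw [← ofReal_norm]
        exact ENNReal.ofReal_le_ofReal (hd z hz x hx)
    _ = ENNReal.ofReal d * ∫⁻ s in Ioc 0 t, ∫⁻ z in D, ‖fderiv ℝ v (x + s • (z - x))‖ₑ ∂μ := by
        rw [lintegral_lintegral_swap (hm.const_mul _).aemeasurable,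
          ← lintegral_const_mul' _ _ ENNReal.ofReal_ne_top]
        simp_rw [lintegral_const_mul' _ _ ENNReal.ofReal_ne_top]
    _ ≤ ENNReal.ofReal d * ∫⁻ s in Ioc 0 t, ENNReal.ofReal (s ^ (lam - 1)) * A := by
        gcongr ENNReal.ofReal d * ?_
        refine setLIntegral_mono' measurableSet_Ioc fun s hs => ?_
        exact setLIntegral_homothety_le_rpow μ hD hDm hc.enorm.measurable hp hlam hx hs.1
          (hs.2.trans ht1)
    _ = _ := by
        rw [lintegral_mul_const _ (by fun_prop), lintegral_Ioc_rpow hlam0 ht, ← mul_assoc,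
          ← ENNReal.ofReal_mul hd0, mul_div_assoc]

/-- Middle leg: between the shrunken copies of `D` centred at `x` and at `y`. The ratio `t` stays
fixed while the centre runs along the segment from `y` to `x`, so the image of `z` moves by only `(1
- t) • (x - y)`. -/
theorem setLIntegral_homothety_sub_homothety_le {v : E → ℝ} (hv : ContDiff ℝ 1 v)
    {D : Set E} (hD : Convex ℝ D) (hDm : MeasurableSet D) {p lam : ℝ} (hp : 1 ≤ p)
    (hlam : Module.finrank ℝ E / p ≤ 1 - lam) {x y : E} (hx : x ∈ D) (hy : y ∈ D) {t : ℝ}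
    (ht : 0 < t) (ht1 : t ≤ 1) :
    ∫⁻ z in D, ‖v (x + t • (z - x)) - v (y + t • (z - y))‖ₑ ∂μ
      ≤ ENNReal.ofReal (‖x - y‖ * t ^ (lam - 1)) *
        ((∫⁻ z in D, ‖fderiv ℝ v z‖ₑ ^ p ∂μ) ^ (1 / p) * μ D ^ (1 - 1 / p)) := by
  have hc : Continuous (fderiv ℝ v) := hv.continuous_fderiv one_ne_zero
  set A := (∫⁻ z in D, ‖fderiv ℝ v z‖ₑ ^ p ∂μ) ^ (1 / p) * μ D ^ (1 - 1 / p)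
  have hm : Measurable (fun q : E × ℝ => ‖fderiv ℝ v
      ((y + q.2 • (x - y)) + t • (q.1 - (y + q.2 • (x - y))))‖ₑ) :=
    (hc.comp (by fun_prop)).enorm.measurable
  calc ∫⁻ z in D, ‖v (x + t • (z - x)) - v (y + t • (z - y))‖ₑ ∂μ
      ≤ ∫⁻ z in D, (∫⁻ s in Ioc (0 : ℝ) 1, ENNReal.ofReal ‖x - y‖ *
          ‖fderiv ℝ v ((y + s • (x - y)) + t • (z - (y + s • (x - y))))‖ₑ) ∂μ := by
        refine setLIntegral_mono' hDm fun z hz => ?_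
        have h := enorm_sub_le_lintegral_fderiv hv (y + t • (z - y)) ((1 - t) • (x - y))
          zero_le_one
        have e : (y + t • (z - y)) + (1 : ℝ) • (1 - t) • (x - y) = x + t • (z - x) := by module
        rw [e] at h
        refine h.trans (lintegral_mono fun s => ?_)
        have e' : (y + t • (z - y)) + s • (1 - t) • (x - y)
          = (y + s • (x - y)) + t • (z - (y + s • (x - y))) := by module
        rw [e', mul_comm]
        gcongr
        rw [← ofReal_norm, norm_smul, Real.norm_of_nonneg (by linarith)]
        exact ENNReal.ofReal_le_ofReal (mul_le_of_le_one_left (norm_nonneg _) (by linarith))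
    _ = ENNReal.ofReal ‖x - y‖ * ∫⁻ s in Ioc (0 : ℝ) 1, ∫⁻ z in D,
          ‖fderiv ℝ v ((y + s • (x - y)) + t • (z - (y + s • (x - y))))‖ₑ ∂μ := by
        rw [lintegral_lintegral_swap (hm.const_mul _).aemeasurable,
          ← lintegral_const_mul' _ _ ENNReal.ofReal_ne_top]
        simp_rw [lintegral_const_mul' _ _ ENNReal.ofReal_ne_top]
    _ ≤ ENNReal.ofReal ‖x - y‖ * ∫⁻ s in Ioc (0 : ℝ) 1, ENNReal.ofReal (t ^ (lam - 1)) * A := by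
        gcongr ENNReal.ofReal _ * ?_
        refine setLIntegral_mono' measurableSet_Ioc fun s hs => ?_
        exact setLIntegral_homothety_le_rpow μ hD hDm hc.enorm.measurable hp hlam
          (hD.homothety_mem hy hx hs.1.le hs.2) ht ht1
    _ = _ := by
        rw [lintegral_const, Measure.restrict_apply_univ, Real.volume_Ioc, sub_zero,
          ENNReal.ofReal_one, mul_one, ← mul_assoc, ← ENNReal.ofReal_mul (norm_nonneg _)]

/-- Morrey's inequality on a bounded convex set. -/
theorem enorm_sub_le_of_contDiff {v : E → ℝ} (hv : ContDiff ℝ 1 v)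
    {D : Set E} (hD : Convex ℝ D) (hDm : MeasurableSet D) (hD0 : μ D ≠ 0) (hDt : μ D ≠ ⊤) {d : ℝ}
    (hd : ∀ x ∈ D, ∀ y ∈ D, ‖x - y‖ ≤ d) {p lam : ℝ} (hp : 1 ≤ p) (hlam0 : 0 < lam)
    (hlam : Module.finrank ℝ E / p ≤ 1 - lam) {x y : E} (hx : x ∈ D) (hy : y ∈ D) :
    ‖v x - v y‖ₑ ≤ ENNReal.ofReal (d ^ (1 - lam) * (2 / lam + 1) * ‖x - y‖ ^ lam) *
      ((∫⁻ z in D, ‖fderiv ℝ v z‖ₑ ^ p ∂μ) ^ (1 / p) * μ D ^ (-(1 / p))) := by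
  rcases eq_or_ne x y with rfl | hxy
  · simp
  have hn : 0 < ‖x - y‖ := norm_sub_pos_iff.2 hxy
  have hd0 : 0 < d := hn.trans_le (hd x hx y hy)
  -- With this ratio `d * t ^ lam` and `‖x - y‖ * t ^ (lam - 1)` are both `d ^ (1 - lam) * ‖x - y‖ ^
  -- lam`, so the three legs add up to the factor `2 / lam + 1`.
  set t := ‖x - y‖ / d with ht
  have ht0 : 0 < t := by positivity
  have ht1 : t ≤ 1 := (div_le_one hd0).2 (hd x hx y hy)
  set I := (∫⁻ z in D, ‖fderiv ℝ v z‖ₑ ^ p ∂μ) ^ (1 / p)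
  have hvc := hv.continuous
  have hm : ∀ w : E, Measurable fun z => ‖v (w + t • (z - w)) - v w‖ₑ := fun w =>
    (Continuous.enorm (by fun_prop)).measurable
  have h1 : ∫⁻ z in D, ‖v x - v y‖ₑ ∂μ
      ≤ ∫⁻ z in D, ‖v (x + t • (z - x)) - v x‖ₑ ∂μ
        + ∫⁻ z in D, ‖v (x + t • (z - x)) - v (y + t • (z - y))‖ₑ ∂μ
        + ∫⁻ z in D, ‖v (y + t • (z - y)) - v y‖ₑ ∂μ := by
    rw [← lintegral_add_left (hm x), ← lintegral_add_right _ (hm y)]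
    refine lintegral_mono fun z => ?_
    have e : v x - v y = -(v (x + t • (z - x)) - v x)
      + (v (x + t • (z - x)) - v (y + t • (z - y))) + (v (y + t • (z - y)) - v y) := by ring
    calc ‖v x - v y‖ₑ ≤ ‖-(v (x + t • (z - x)) - v x)‖ₑ
          + ‖v (x + t • (z - x)) - v (y + t • (z - y))‖ₑ + ‖v (y + t • (z - y)) - v y‖ₑ := by
          rw [e]
          exact (enorm_add_le _ _).trans (by gcongr; exact enorm_add_le _ _)
      _ = _ := by rw [enorm_neg]
  have h2 := h1.trans (add_le_add (add_le_add
    (setLIntegral_sub_homothety_le μ hv hD hDm hd hp hlam0 hlam hx ht0.le ht1)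
    (setLIntegral_homothety_sub_homothety_le μ hv hD hDm hp hlam hx hy ht0 ht1))
    (setLIntegral_sub_homothety_le μ hv hD hDm hd hp hlam0 hlam hy ht0.le ht1))
  rw [lintegral_const, Measure.restrict_apply_univ, ← add_mul, ← add_mul,
    ← ENNReal.ofReal_add (by positivity) (by positivity),
    ← ENNReal.ofReal_add (by positivity) (by positivity)] at h2
  have e : d * t ^ lam / lam + ‖x - y‖ * t ^ (lam - 1) + d * t ^ lam / lam
      = d ^ (1 - lam) * (2 / lam + 1) * ‖x - y‖ ^ lam := by
    have hxd : ‖x - y‖ = d * t := by rw [ht]; field_simp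
    rw [hxd, Real.mul_rpow hd0.le ht0.le, Real.rpow_sub_one ht0.ne', Real.rpow_sub hd0,
      Real.rpow_one]
    have := (Real.rpow_pos_of_pos hd0 lam).ne'
    field_simp
    ring
  rw [e] at h2
  -- The left side was integrated over `D`; dividing by `μ D` turns the Hölder factor `μ D ^ (1 - 1
  -- / p)` into `μ D ^ (-(1 / p))`.
  have h3 : ‖v x - v y‖ₑ * μ D * (μ D)⁻¹ = ‖v x - v y‖ₑ := by
    rw [mul_assoc, ENNReal.mul_inv_cancel hD0 hDt, mul_one]
  rw [← h3]
  refine (mul_le_mul_left h2 _).trans (le_of_eq ?_)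
  have h4 : μ D ^ (1 - 1 / p) * (μ D)⁻¹ = μ D ^ (-(1 / p)) := by
    rw [← ENNReal.rpow_neg_one, ← ENNReal.rpow_add _ _ hD0 hDt]
    congr 1
    ring
  rw [← h4]
  simp only [I, mul_assoc]

end Morrey

/-! ## Mollification -/

section Mollify

open ContinuousLinearMap
open scoped Convolution

variable {E : Type*} [NormedAddCommGroup E] [NormedSpace ℝ E] [FiniteDimensional ℝ E]
  [MeasurableSpace E] [BorelSpace E] (μ : Measure E) [μ.IsAddHaarMeasure]

/-- The normalised bump is a probability density `ν`, so Jensen's inequality (comparison of the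
`L¹(ν)` and `L^p(ν)` norms) bounds the `p`-th power of the convolution pointwise. Tonelli and
translation invariance finish. -/
theorem ContDiffBump.eLpNorm_convolution_le (φ : ContDiffBump (0 : E)) {g : E → ℝ}
    (hg : StronglyMeasurable g) {p : ℝ≥0∞} (hp : 1 ≤ p) (hpt : p ≠ ⊤) :
    eLpNorm (φ.normed μ ⋆[lsmul ℝ ℝ, μ] g) p μ ≤ eLpNorm g p μ := by
  have hp0 : p ≠ 0 := (one_pos.trans_le hp).ne'
  have hq : 1 ≤ p.toReal := by simpa using ENNReal.toReal_mono hpt hp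
  have hφm : Measurable fun t => ENNReal.ofReal (φ.normed μ t) :=
    φ.continuous_normed.measurable.ennreal_ofReal
  set ν := μ.withDensity fun t => ENNReal.ofReal (φ.normed μ t) with hν
  have hν1 : ν univ = 1 := by
    rw [hν, withDensity_apply _ MeasurableSet.univ, Measure.restrict_univ,
      ← ofReal_integral_eq_lintegral_ofReal φ.integrable_normed
        (Filter.Eventually.of_forall φ.nonneg_normed), φ.integral_normed, ENNReal.ofReal_one]
  have hpt' : ∀ x, ‖(φ.normed μ ⋆[lsmul ℝ ℝ, μ] g) x‖ₑ ^ p.toReal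
      ≤ ∫⁻ t, ENNReal.ofReal (φ.normed μ t) * ‖g (x - t)‖ₑ ^ p.toReal ∂μ := by
    intro x
    have hm : StronglyMeasurable fun t => g (x - t) :=
      hg.comp_measurable (measurable_const.sub measurable_id)
    have h1 : ‖(φ.normed μ ⋆[lsmul ℝ ℝ, μ] g) x‖ₑ ≤ ∫⁻ t, ‖g (x - t)‖ₑ ∂ν := by
      rw [convolution_lsmul, hν, lintegral_withDensity_eq_lintegral_mul _ hφm hm.enorm]
      refine (enorm_integral_le_lintegral_enorm _).trans_eq (lintegral_congr fun t => ?_)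
      rw [enorm_smul, Pi.mul_apply, Real.enorm_of_nonneg (φ.nonneg_normed t)]
    have h2 := eLpNorm'_le_eLpNorm'_mul_rpow_measure_univ (μ := ν) one_pos hq
      hm.aestronglyMeasurable
    simp only [eLpNorm'_eq_lintegral_enorm, ENNReal.rpow_one, div_one, hν1, ENNReal.one_rpow,
      mul_one] at h2
    have h3 := ENNReal.rpow_le_rpow (h1.trans h2) (by linarith : 0 ≤ p.toReal)
    rw [← ENNReal.rpow_mul, one_div, inv_mul_cancel₀ (by linarith), ENNReal.rpow_one, hν,
      lintegral_withDensity_eq_lintegral_mul _ hφm (hm.enorm.pow_const _)] at h3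
    exact h3
  rw [eLpNorm_eq_lintegral_rpow_enorm_toReal hp0 hpt, eLpNorm_eq_lintegral_rpow_enorm_toReal hp0 hpt]
  refine ENNReal.rpow_le_rpow ?_ (by positivity)
  refine (lintegral_mono hpt').trans ?_
  rw [lintegral_lintegral_swap]
  · have : ∀ t, ∫⁻ x, ENNReal.ofReal (φ.normed μ t) * ‖g (x - t)‖ₑ ^ p.toReal ∂μ
        = ENNReal.ofReal (φ.normed μ t) * ∫⁻ x, ‖g x‖ₑ ^ p.toReal ∂μ := by
      intro t
      rw [lintegral_const_mul' _ _ ENNReal.ofReal_ne_top,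
        lintegral_sub_right_eq_self (fun x => ‖g x‖ₑ ^ p.toReal) t]
    simp_rw [this]
    rw [lintegral_mul_const _ hφm]
    have h4 : ∫⁻ t, ENNReal.ofReal (φ.normed μ t) ∂μ = 1 := by
      rw [← hν1, hν, withDensity_apply _ MeasurableSet.univ, Measure.restrict_univ]
    rw [h4, one_mul]
  · refine Measurable.aemeasurable ?_
    have hm : Measurable fun q : E × E => g (q.1 - q.2) :=
      hg.measurable.comp (measurable_fst.sub measurable_snd)
    exact (hφm.comp measurable_snd).mul (hm.enorm.pow_const _)

theorem ContDiffBump.contDiff_convolution (φ : ContDiffBump (0 : E)) {g : E → ℝ}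
    (hg : LocallyIntegrable g μ) {k : ℕ∞} :
    ContDiff ℝ k (φ.normed μ ⋆[lsmul ℝ ℝ, μ] g) :=
  φ.hasCompactSupport_normed.contDiff_convolution_left _ φ.contDiff_normed hg

/-- The derivative falls on the bump, so the right side pairs `g` with the derivative of a smooth
test function, ready for the definition of a weak derivative. -/
theorem ContDiffBump.fderiv_convolution_apply (φ : ContDiffBump (0 : E)) {g : E → ℝ}
    (hg : LocallyIntegrable g μ) (x v : E) :
    fderiv ℝ (φ.normed μ ⋆[lsmul ℝ ℝ, μ] g) x v
      = ∫ t, g t * fderiv ℝ (φ.normed μ) (x - t) v ∂μ := by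
  have hφ : ContDiff ℝ 1 (φ.normed μ) := φ.contDiff_normed
  -- The flipped bilinear map makes the bump the right factor, the one being differentiated.
  have h := φ.hasCompactSupport_normed.hasFDerivAt_convolution_right (μ := μ)
    (lsmul ℝ ℝ : ℝ →L[ℝ] ℝ →L[ℝ] ℝ).flip hg hφ x
  rw [convolution_flip] at h
  rw [h.fderiv, convolution_precompR_apply _ hg (φ.hasCompactSupport_normed.fderiv ℝ)
    (hφ.continuous_fderiv one_ne_zero)]
  simp only [convolution_def, flip_apply, lsmul_apply, smul_eq_mul, mul_comm]

end Mollify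

namespace OrliczSobolev

/-! ### Mollification of weak derivatives on a ball -/

section BallMollify

open ContinuousLinearMap
open scoped Convolution

variable {n : ℕ} {ρ : ℝ}

theorem integral_indicator_ball_mul (f : EuclideanSpace ℝ (Fin n) → ℝ)
    (g : EuclideanSpace ℝ (Fin n) → ℝ) :
    ∫ t, (Metric.ball 0 ρ).indicator f t * g t = ∫ t in Metric.ball 0 ρ, f t * g t := by
  rw [← integral_indicator measurableSet_ball]
  refine integral_congr_ae (Filter.Eventually.of_forall fun t => ?_)
  simp only [indicator_mul_left]

/-- In the interior, the partial derivatives of a mollification are the mollifications of the weak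
partial derivatives. -/
theorem IsBallWeakDeriv.fderiv_convolution {i : Fin n}
    {f g : EuclideanSpace ℝ (Fin n) →ₘ[ballMeasure n ρ] ℝ} (h : IsBallWeakDeriv ρ i f g)
    (hf : Integrable f (ballMeasure n ρ))
    (φ : ContDiffBump (0 : EuclideanSpace ℝ (Fin n))) {x : EuclideanSpace ℝ (Fin n)}
    (hx : Metric.closedBall x φ.rOut ⊆ Metric.ball 0 ρ) :
    fderiv ℝ (φ.normed volume ⋆[lsmul ℝ ℝ, volume] (Metric.ball 0 ρ).indicator f) x
        (EuclideanSpace.single i 1)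
      = (φ.normed volume ⋆[lsmul ℝ ℝ, volume] (Metric.ball 0 ρ).indicator g) x := by
  have hint : LocallyIntegrable ((Metric.ball 0 ρ).indicator f) volume :=
    ((integrable_indicator_iff measurableSet_ball).2 hf).locallyIntegrable
  -- The value of a mollification at `x` is a pairing with `ψ`. Its support lies in the closed ball
  -- around `x`, which `hx` places inside `B_ρ`, so `ψ` is an admissible test function.
  set ψ : EuclideanSpace ℝ (Fin n) → ℝ := fun t => φ.normed volume (x - t) with hψ
  have hψs : ContDiff ℝ ((⊤ : ℕ∞) : WithTop ℕ∞) ψ :=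
    φ.contDiff_normed.comp (contDiff_const.sub contDiff_id)
  have hψt : tsupport ψ ⊆ Metric.closedBall x φ.rOut := by
    refine closure_minimal (fun t ht => ?_) Metric.isClosed_closedBall
    have h1 : x - t ∈ Function.support (φ.normed volume) := ht
    rw [φ.support_normed_eq, mem_ball_zero_iff] at h1
    rw [mem_closedBall_iff_norm']
    exact h1.le
  have hψc : HasCompactSupport ψ :=
    (isCompact_closedBall x φ.rOut).of_isClosed_subset (isClosed_tsupport _) hψt
  -- The sign from the reflection `t ↦ x - t` cancels the sign in the definition of the weak
  -- derivative.
  have hd : ∀ t, partialDeriv i ψ t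
      = -(fderiv ℝ (φ.normed volume) (x - t) (EuclideanSpace.single i 1)) := by
    intro t
    have hφ : ContDiff ℝ 1 (φ.normed (volume : Measure (EuclideanSpace ℝ (Fin n)))) :=
      φ.contDiff_normed
    have h1 := ((hφ.differentiable one_ne_zero) (x - t)).hasFDerivAt.comp t
      ((hasFDerivAt_id t).const_sub x)
    rw [partialDeriv]
    have h2 : fderiv ℝ ψ t = _ := h1.fderiv
    rw [h2]
    simp
  have key := h ψ hψs hψc (hψt.trans hx)
  rw [φ.fderiv_convolution_apply volume hint, integral_indicator_ball_mul, convolution_lsmul_swap]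
  simp only [smul_eq_mul, mul_comm (φ.normed volume _)]
  rw [integral_indicator_ball_mul, key, ← integral_neg]
  simp [hd]

theorem norm_le_sum_partialDeriv (L : EuclideanSpace ℝ (Fin n) →L[ℝ] ℝ) :
    ‖L‖ ≤ ∑ i, ‖L (EuclideanSpace.single i 1)‖ := by
  refine L.opNorm_le_bound (Finset.sum_nonneg fun i _ => norm_nonneg _) fun z => ?_
  have hz : z = ∑ i, z i • EuclideanSpace.single i (1 : ℝ) := by
    conv_lhs => rw [← (EuclideanSpace.basisFun (Fin n) ℝ).sum_repr z]
    simp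
  conv_lhs => rw [hz, map_sum]
  rw [Finset.sum_mul]
  refine (norm_sum_le _ _).trans (Finset.sum_le_sum fun i _ => ?_)
  rw [map_smul, norm_smul, mul_comm]
  gcongr
  exact PiLp.norm_apply_le z i

end BallMollify

end OrliczSobolev

/-- For `r ≤ 1` the snowflake `d ^ r` is again a metric, and `r`-Hölder for `d` means Lipschitz for
`d ^ r`; the extension theorem for real Lipschitz functions applies with the same constant. -/
theorem HolderOnWith.extend_real {X : Type*} [PseudoMetricSpace X] {f : X → ℝ} {s : Set X}
    {C r : ℝ≥0} (hr0 : 0 < r) (hr1 : r ≤ 1) (hf : HolderOnWith C r f s) :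
    ∃ g : X → ℝ, HolderWith C r g ∧ EqOn f g s := by
  have hr0' : (0 : ℝ) < r := hr0
  have hr1' : (r : ℝ) ≤ 1 := hr1
  have h : LipschitzOnWith C
      (f ∘ (Metric.Snowflaking.ofSnowflaking : Metric.Snowflaking X r hr0' hr1' → X))
      (Metric.Snowflaking.ofSnowflaking ⁻¹' s) := by
    intro x hx y hy
    rw [Metric.Snowflaking.edist_def]
    exact hf _ hx _ hy
  obtain ⟨g, hg, hfg⟩ := h.extend_real
  refine ⟨g ∘ Metric.Snowflaking.toSnowflaking, fun x y => ?_, fun x hx => ?_⟩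
  · have := hg (Metric.Snowflaking.toSnowflaking x) (Metric.Snowflaking.toSnowflaking y)
    rwa [Metric.Snowflaking.edist_toSnowflaking_toSnowflaking] at this
  · exact hfg (x := Metric.Snowflaking.toSnowflaking x) hx

namespace OrliczSobolev

/-! ### Morrey's inequality for Sobolev functions on a ball -/

section MorreyBall

open ContinuousLinearMap
open scoped Convolution

variable {n : ℕ} {ρ : ℝ} {p : ℝ≥0∞}

theorem eLpNorm_indicator_Lp (f : Lp ℝ p (ballMeasure n ρ)) :
    eLpNorm ((Metric.ball 0 ρ).indicator f) p volume = ENNReal.ofReal ‖f‖ := by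
  rw [eLpNorm_indicator_eq_eLpNorm_restrict measurableSet_ball, Lp.norm_def,
    ENNReal.ofReal_toReal (Lp.eLpNorm_ne_top f)]

variable [Fact (1 ≤ p)]

theorem BallSobolev.isBallWeakDeriv (u : BallSobolev n p ρ) (i : Fin n) :
    IsBallWeakDeriv ρ i (toLp u : EuclideanSpace ℝ (Fin n) →ₘ[ballMeasure n ρ] ℝ)
      (weakDeriv i u : Lp ℝ p (ballMeasure n ρ)) :=
  ballGrad_spec u i

instance : IsFiniteMeasure (ballMeasure n ρ) :=
  ⟨by rw [Measure.restrict_apply_univ]; exact measure_ball_lt_top⟩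

/-- The gradient of a mollification is bounded, in `L^p` of a smaller ball, by the Sobolev norm. -/
theorem BallSobolev.eLpNorm_fderiv_convolution_le (hp : p ≠ ⊤) (u : BallSobolev n p ρ)
    (φ : ContDiffBump (0 : EuclideanSpace ℝ (Fin n))) {r : ℝ} (hr : r + φ.rOut ≤ ρ) :
    eLpNorm (fderiv ℝ
      (φ.normed volume ⋆[lsmul ℝ ℝ, volume] (Metric.ball 0 ρ).indicator (toLp u))) p
        (ballMeasure n r) ≤ ENNReal.ofReal ‖u‖ := by
  have hp1 : 1 ≤ p := Fact.out
  have hloc : ∀ f : Lp ℝ p (ballMeasure n ρ),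
      LocallyIntegrable ((Metric.ball 0 ρ).indicator f) volume := fun f =>
    ((integrable_indicator_iff measurableSet_ball).2
      ((Lp.memLp f).integrable hp1)).locallyIntegrable
  set G : Fin n → EuclideanSpace ℝ (Fin n) → ℝ := fun i =>
    φ.normed volume ⋆[lsmul ℝ ℝ, volume] (Metric.ball 0 ρ).indicator (weakDeriv i u) with hG
  have hGc : ∀ i, Continuous (G i) := fun i =>
    (φ.contDiff_convolution volume (hloc _) (k := 0)).continuous
  have h1 : ∀ x ∈ Metric.ball (0 : EuclideanSpace ℝ (Fin n)) r,
      ‖fderiv ℝ (φ.normed volume ⋆[lsmul ℝ ℝ, volume]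
        (Metric.ball 0 ρ).indicator (toLp u)) x‖ ≤ ‖(∑ i, fun x => ‖G i x‖) x‖ := by
    intro x hx
    refine (norm_le_sum_partialDeriv _).trans (le_of_eq ?_)
    rw [Finset.sum_apply, Real.norm_of_nonneg (Finset.sum_nonneg fun i _ => norm_nonneg _)]
    refine Finset.sum_congr rfl fun i _ => ?_
    rw [(u.isBallWeakDeriv i).fderiv_convolution ((Lp.memLp (toLp u)).integrable hp1)]
    refine Metric.closedBall_subset_ball' ?_
    rw [mem_ball_iff_norm, sub_zero] at hx
    rw [dist_zero_right]
    linarith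
  calc _ ≤ eLpNorm (∑ i, fun x => ‖G i x‖) p (ballMeasure n r) :=
        eLpNorm_mono_ae ((ae_restrict_iff' measurableSet_ball).2
          (Filter.Eventually.of_forall h1))
    _ ≤ ∑ i, eLpNorm (fun x => ‖G i x‖) p (ballMeasure n r) :=
        eLpNorm_sum_le (fun i _ => (hGc i).norm.aestronglyMeasurable) hp1
    _ ≤ ∑ i, ENNReal.ofReal ‖weakDeriv i u‖ := by
        refine Finset.sum_le_sum fun i _ => ?_
        -- The smaller ball is enlarged to the whole space, where the convolution bound applies to
        -- the weak derivative extended by zero.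
        rw [eLpNorm_norm, ← eLpNorm_indicator_Lp]
        exact (eLpNorm_mono_measure _ Measure.restrict_le_self).trans
          (φ.eLpNorm_convolution_le volume
            ((Lp.stronglyMeasurable _).indicator measurableSet_ball) hp1 hp)
    _ ≤ ENNReal.ofReal ‖u‖ := by
        rw [← ENNReal.ofReal_sum_of_nonneg fun i _ => norm_nonneg _, norm_eq u]
        exact ENNReal.ofReal_le_ofReal (le_add_of_nonneg_left (norm_nonneg _))

/-- Morrey's inequality: off a null set, a function in `W^{1,p}(B_ρ)` is Hölder continuous. -/
theorem BallSobolev.exists_holderOnWith (n : ℕ) (hρ : 0 < ρ) {lam : ℝ≥0}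
    (hlam0 : 0 < lam) (hp : p ≠ ⊤) (hlam : (n : ℝ) / p.toReal ≤ 1 - lam) :
    ∃ C : ℝ≥0, ∀ u : BallSobolev n p ρ, ∃ S : Set (EuclideanSpace ℝ (Fin n)),
      (∀ᵐ x ∂ballMeasure n ρ, x ∈ S) ∧ HolderOnWith (C * ‖u‖₊) lam (toLp u) S := by
  have hp1 : 1 ≤ p := Fact.out
  have hq : 1 ≤ p.toReal := by simpa using ENNReal.toReal_mono hp hp1
  have hp0 : p ≠ 0 := (one_pos.trans_le hp1).ne'
  have hlam0' : (0 : ℝ) < lam := hlam0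
  -- Morrey's inequality will be used on balls of radius `r` between `ρ / 2` and `ρ`. The exponent
  -- of the volume is negative, so the smallest radius bounds this factor uniformly in `r`.
  set c : ℝ≥0∞ := volume (Metric.ball (0 : EuclideanSpace ℝ (Fin n)) (ρ / 2)) ^ (-(1 / p.toReal))
    with hc
  have hct : c ≠ ⊤ := by
    refine ENNReal.rpow_ne_top_of_ne_zero ?_ measure_ball_lt_top.ne
    exact (Metric.measure_ball_pos _ _ (by linarith)).ne'
  set K : ℝ := (2 * ρ) ^ (1 - (lam : ℝ)) * (2 / lam + 1) with hK
  have hK0 : 0 ≤ K := by positivity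
  refine ⟨K.toNNReal * c.toNNReal, fun u => ?_⟩
  set U := (Metric.ball 0 ρ).indicator (toLp u : EuclideanSpace ℝ (Fin n) → ℝ) with hU
  have hUloc : LocallyIntegrable U volume :=
    ((integrable_indicator_iff measurableSet_ball).2
      ((Lp.memLp (toLp u)).integrable hp1)).locallyIntegrable
  -- The outer radii tend to `0` and are twice the inner ones; the a.e. convergence of the
  -- mollifications requires this ratio to stay bounded.
  let φ : ℕ → ContDiffBump (0 : EuclideanSpace ℝ (Fin n)) := fun k =>
    ⟨1 / (k + 1) / 2, 1 / (k + 1), by positivity, half_lt_self (by positivity)⟩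
  have hφ : Filter.Tendsto (fun k => (φ k).rOut) Filter.atTop (nhds 0) :=
    tendsto_one_div_add_atTop_nhds_zero_nat
  set V : ℕ → EuclideanSpace ℝ (Fin n) → ℝ := fun k =>
    (φ k).normed volume ⋆[lsmul ℝ ℝ, volume] U
  have hV : ∀ k, ContDiff ℝ 1 (V k) := fun k =>
    (φ k).contDiff_convolution volume hUloc (k := 1)
  have hae := ContDiffBump.ae_convolution_tendsto_right_of_locallyIntegrable (K := 2) hφ
    (Filter.Eventually.of_forall fun k =>
      (by change (1 / (k + 1) : ℝ) ≤ 2 * (1 / (k + 1) / 2); linarith)) hUloc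
  -- The full-measure set consists of the points of the ball where the mollifications converge to
  -- `U`; the estimate passes to the limit exactly there.
  refine ⟨{x | x ∈ Metric.ball 0 ρ ∧ Filter.Tendsto (fun k => V k x) Filter.atTop (nhds (U x))},
    ?_, ?_⟩
  · filter_upwards [ae_restrict_mem measurableSet_ball, ae_restrict_of_ae hae] with x h1 h2
      using ⟨h1, h2⟩
  rintro x ⟨hx, hxt⟩ y ⟨hy, hyt⟩
  -- The ball of radius `r` contains both points and leaves a margin `ρ - r`; the gradient bound
  -- holds once the mollification radius is below this margin.
  obtain ⟨r, hr1, hr2⟩ := exists_between (max_lt (max_lt (mem_ball_zero_iff.1 hx)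
    (mem_ball_zero_iff.1 hy)) (half_lt_self hρ))
  have hxr : x ∈ Metric.ball 0 r := mem_ball_zero_iff.2
    (((le_max_left _ _).trans (le_max_left _ _)).trans_lt hr1)
  have hyr : y ∈ Metric.ball 0 r := mem_ball_zero_iff.2
    (((le_max_right _ _).trans (le_max_left _ _)).trans_lt hr1)
  have hr : ρ / 2 < r := (le_max_right _ _).trans_lt hr1
  have hr0 : 0 < r := by linarith
  rw [← indicator_of_mem hx (toLp u : EuclideanSpace ℝ (Fin n) → ℝ),
    ← indicator_of_mem hy (toLp u : EuclideanSpace ℝ (Fin n) → ℝ), edist_eq_enorm_sub]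
  refine le_of_tendsto (hxt.sub hyt).enorm ?_
  filter_upwards [hφ.eventually_lt_const (by linarith : 0 < ρ - r)] with k hk
  have h1 := enorm_sub_le_of_contDiff volume (hV k) (convex_ball 0 r) measurableSet_ball
    (Metric.measure_ball_pos _ _ hr0).ne' measure_ball_lt_top.ne (d := 2 * ρ)
    (fun a ha b hb => by
      have := norm_sub_le a b
      rw [mem_ball_zero_iff] at ha hb
      linarith) hq hlam0' (by rwa [finrank_euclideanSpace_fin]) hxr hyr
  have h2 := u.eLpNorm_fderiv_convolution_le hp (φ k) (r := r) (by linarith)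
  rw [eLpNorm_eq_lintegral_rpow_enorm_toReal hp0 hp] at h2
  refine h1.trans ?_
  rw [ENNReal.ofReal_mul hK0, ENNReal.coe_mul, ENNReal.coe_mul, ENNReal.coe_toNNReal hct,
    edist_eq_enorm_sub, ← ofReal_norm (x - y),
    ENNReal.ofReal_rpow_of_nonneg (norm_nonneg _) hlam0'.le]
  change ENNReal.ofReal K * _ * _ ≤ ENNReal.ofReal K * c * ‖u‖ₑ * _
  rw [← ofReal_norm u]
  have h3 : volume (Metric.ball (0 : EuclideanSpace ℝ (Fin n)) r) ^ (-(1 / p.toReal)) ≤ c := by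
    rw [hc, ENNReal.rpow_neg, ENNReal.rpow_neg, ENNReal.inv_le_inv]
    gcongr
  refine (mul_le_mul_right (mul_le_mul' h2 h3) _).trans (le_of_eq ?_)
  ring

end MorreyBall

end OrliczSobolev

namespace OrliczSobolev

/-! ### The embedding in the Hölder space of the closed ball -/

section HolderEmbedding

variable {n : ℕ} {ρ : ℝ} {lam : ℝ≥0} {p : ℝ≥0∞}

/-- A function in `C^lam` of the closed ball is determined by its values a.e. in the ball. -/
theorem BallHolder.ext_ae (hρ : 0 < ρ) {g h : BallHolder n lam ρ}
    (hgh : ∀ᵐ x : EuclideanSpace ℝ (Fin n), ∀ hx : x ∈ Metric.ball 0 ρ,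
      toContinuousMap g ⟨x, Metric.ball_subset_closedBall hx⟩
        = toContinuousMap h ⟨x, Metric.ball_subset_closedBall hx⟩) : g = h := by
  classical
  let F : BallHolder n lam ρ → EuclideanSpace ℝ (Fin n) → ℝ := fun k x =>
    if hx : x ∈ Metric.closedBall 0 ρ then toContinuousMap k ⟨x, hx⟩ else 0
  have hF : ∀ k, ∀ x : Metric.closedBall (0 : EuclideanSpace ℝ (Fin n)) ρ,
      F k x = toContinuousMap k x := fun k x => dif_pos x.2
  have hFc : ∀ k, ContinuousOn (F k) (Metric.closedBall 0 ρ) := fun k => by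
    rw [continuousOn_iff_continuous_domRestrict]
    exact (toContinuousMap k).continuous.congr fun x => (hF k x).symm
  have hae : F g =ᵐ[volume.restrict (Metric.ball 0 ρ)] F h := by
    refine (ae_restrict_iff' measurableSet_ball).2 ?_
    filter_upwards [hgh] with x hx hxb
    exact (hF g ⟨x, Metric.ball_subset_closedBall hxb⟩).trans
      ((hx hxb).trans (hF h ⟨x, Metric.ball_subset_closedBall hxb⟩).symm)
  -- By continuity a.e. equality becomes equality on the open ball, and then on its closure, which
  -- is the closed ball as `ρ ≠ 0`.
  have heq : EqOn (F g) (F h) (Metric.closedBall 0 ρ) :=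
    (Measure.eqOn_open_of_ae_eq hae Metric.isOpen_ball
      ((hFc g).mono Metric.ball_subset_closedBall)
      ((hFc h).mono Metric.ball_subset_closedBall)).of_subset_closure (hFc g) (hFc h)
      Metric.ball_subset_closedBall (closure_ball _ hρ.ne').ge
  refine Subtype.ext (ContinuousMap.ext fun x => ?_)
  have := heq x.2
  rwa [hF, hF] at this

/-- Taking `L^p` norms in `y` of the hypothesis turns the constant `|a|` into `|a|` times the volume
to the power `1 / p`; division by that factor gives the bound. It converts control of oscillation
into control of the supremum. -/
theorem BallSobolev.abs_le_of_oscillation [Fact (1 ≤ p)] (hρ : 0 < ρ)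
    (u : BallSobolev n p ρ) {a M : ℝ} (hM : 0 ≤ M)
    (h : ∀ᵐ y ∂ballMeasure n ρ, |a| ≤ |toLp u y| + M) :
    |a| ≤ ((volume (Metric.ball (0 : EuclideanSpace ℝ (Fin n)) ρ)) ^ (1 / p.toReal)).toReal⁻¹
      * ‖u‖ + M := by
  have hp1 : 1 ≤ p := Fact.out
  have hp0 : p ≠ 0 := (one_pos.trans_le hp1).ne'
  have hv0 : volume (Metric.ball (0 : EuclideanSpace ℝ (Fin n)) ρ) ≠ 0 :=
    (Metric.measure_ball_pos _ _ hρ).ne'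
  have hμ : ballMeasure n ρ ≠ 0 := by rwa [Ne, Measure.restrict_eq_zero]
  set m := (volume (Metric.ball (0 : EuclideanSpace ℝ (Fin n)) ρ)) ^ (1 / p.toReal) with hm
  have hmt : m ≠ ⊤ := ENNReal.rpow_ne_top_of_nonneg (by positivity) measure_ball_lt_top.ne
  have hm0 : m ≠ 0 := (ENNReal.rpow_pos (Metric.measure_ball_pos _ _ hρ) measure_ball_lt_top.ne).ne'
  have hc : ∀ b : ℝ, eLpNorm (fun _ : EuclideanSpace ℝ (Fin n) => b) p (ballMeasure n ρ)
      = ‖b‖ₑ * m := fun b => by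
    rw [eLpNorm_const _ hp0 hμ, Measure.restrict_apply_univ]
  have h1 : ‖a‖ₑ * m ≤ ENNReal.ofReal ‖toLp u‖ + ‖M‖ₑ * m := by
    set w : EuclideanSpace ℝ (Fin n) → ℝ := fun y => ‖toLp u y‖ with hw
    have h4 : eLpNorm (fun _ : EuclideanSpace ℝ (Fin n) => a) p (ballMeasure n ρ)
        ≤ eLpNorm (w + fun _ => M) p (ballMeasure n ρ) := by
      refine eLpNorm_mono_ae ?_
      filter_upwards [h] with y hy
      rw [Pi.add_apply, Real.norm_of_nonneg (add_nonneg (norm_nonneg _) hM)]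
      exact hy
    have h5 : eLpNorm w p (ballMeasure n ρ) = ENNReal.ofReal ‖toLp u‖ := by
      rw [Lp.norm_def, ENNReal.ofReal_toReal (Lp.eLpNorm_ne_top _), hw, eLpNorm_norm]
    rw [← hc a, ← hc M, ← h5]
    exact h4.trans (eLpNorm_add_le (Lp.aestronglyMeasurable _).norm aestronglyMeasurable_const hp1)
  have h2 := ENNReal.toReal_mono (by finiteness) h1
  rw [ENNReal.toReal_add (by finiteness) (by finiteness), ENNReal.toReal_mul, ENNReal.toReal_mul,
    ENNReal.toReal_ofReal (norm_nonneg _), toReal_enorm, toReal_enorm, Real.norm_eq_abs,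
    Real.norm_of_nonneg hM] at h2
  have hmr : 0 < m.toReal := ENNReal.toReal_pos hm0 hmt
  have h3 : ‖toLp u‖ ≤ ‖u‖ := by
    rw [norm_eq u]
    exact le_add_of_nonneg_right (Finset.sum_nonneg fun i _ => norm_nonneg _)
  rw [← mul_le_mul_iff_left₀ hmr, add_mul, mul_right_comm, inv_mul_cancel₀ hmr.ne', one_mul]
  linarith

/-- The Hölder function on the full-measure set `S` is extended to the whole space and restricted to
the closed ball. This reaches the boundary and the exceptional points without loss in the Hölder
constant. -/
theorem BallSobolev.exists_ballHolder [Fact (1 ≤ p)] (n : ℕ) (hρ : 0 < ρ) (hlam0 : 0 < lam)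
    (hlam1 : lam ≤ 1) (hp : p ≠ ⊤) (hlam : (n : ℝ) / p.toReal ≤ 1 - lam) :
    ∃ C : ℝ, ∀ u : BallSobolev n p ρ, ∃ g : BallHolder n lam ρ, ‖g‖ ≤ C * ‖u‖ ∧
      ∀ᵐ x : EuclideanSpace ℝ (Fin n), ∀ hx : x ∈ Metric.ball 0 ρ,
        BallHolder.toContinuousMap g ⟨x, Metric.ball_subset_closedBall hx⟩
          = (toLp u : EuclideanSpace ℝ (Fin n) → ℝ) x := by
  obtain ⟨C, hC⟩ := BallSobolev.exists_holderOnWith (p := p) n hρ hlam0 hp hlam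
  set m := (volume (Metric.ball (0 : EuclideanSpace ℝ (Fin n)) ρ)) ^ (1 / p.toReal)
  -- The first two terms bound the supremum, `2 * ρ` bounding the distances in the ball; the last
  -- bounds the Hölder seminorm.
  refine ⟨m.toReal⁻¹ + C * (2 * ρ) ^ (lam : ℝ) + C, fun u => ?_⟩
  obtain ⟨S, hS, hSu⟩ := hC u
  obtain ⟨G, hG, hGS⟩ := hSu.extend_real hlam0 hlam1
  have hGr : HolderWith (C * ‖u‖₊) lam
      (fun x : Metric.closedBall (0 : EuclideanSpace ℝ (Fin n)) ρ => G x) :=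
    fun x y => hG x y
  let g : BallHolder n lam ρ :=
    (⟨⟨fun x => G x, hGr.continuous hlam0⟩, ⟨_, hGr⟩⟩ : holderSubmodule n lam ρ)
  refine ⟨g, ?_, ?_⟩
  · rw [BallHolder.norm_eq]
    have h1 : (nnHolderNorm lam (BallHolder.toContinuousMap g) : ℝ) ≤ C * ‖u‖ := by
      exact_mod_cast hGr.nnholderNorm_le
    have h2 : ‖BallHolder.toContinuousMap g‖
        ≤ m.toReal⁻¹ * ‖u‖ + C * ‖u‖ * (2 * ρ) ^ (lam : ℝ) := by
      refine (ContinuousMap.norm_le _ (by positivity)).2 fun x => ?_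
      refine u.abs_le_of_oscillation hρ (by positivity) ?_
      filter_upwards [hS, ae_restrict_mem measurableSet_ball] with y hy hyb
      have h3 := hG.dist_le x.1 y
      have h4 : dist x.1 y ≤ 2 * ρ := by
        have := dist_triangle_right x.1 y 0
        have hx := x.2
        rw [Metric.mem_closedBall] at hx
        rw [Metric.mem_ball] at hyb
        linarith
      have h5 : dist x.1 y ^ (lam : ℝ) ≤ (2 * ρ) ^ (lam : ℝ) :=
        Real.rpow_le_rpow dist_nonneg h4 lam.2
      rw [hGS hy]
      change |G x| ≤ _
      rw [Real.dist_eq] at h3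
      have h6 := abs_sub_abs_le_abs_sub (G x) (G y)
      have h7 : (C : ℝ) * ‖u‖ * dist x.1 y ^ (lam : ℝ) ≤ C * ‖u‖ * (2 * ρ) ^ (lam : ℝ) := by
        gcongr
      rw [NNReal.coe_mul, coe_nnnorm] at h3
      linarith
    linarith
  · have := (ae_restrict_iff' measurableSet_ball).1 hS
    filter_upwards [this] with x hx hxb
    exact (hGS (hx hxb)).symm

/-- Morrey's embedding `W^{1,p}(B_ρ) ⊂ C^lam`. -/
theorem BallSobolev.exists_embedding [Fact (1 ≤ p)] (n : ℕ) (hρ : 0 < ρ) (hlam0 : 0 < lam)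
    (hlam1 : lam ≤ 1) (hp : p ≠ ⊤) (hlam : (n : ℝ) / p.toReal ≤ 1 - lam) :
    ∃ J : BallSobolev n p ρ →L[ℝ] BallHolder n lam ρ, Function.Injective J ∧
      ∀ u : BallSobolev n p ρ, ∀ᵐ x : EuclideanSpace ℝ (Fin n), ∀ hx : x ∈ Metric.ball 0 ρ,
        BallHolder.toContinuousMap (J u) ⟨x, Metric.ball_subset_closedBall hx⟩
          = (toLp u : EuclideanSpace ℝ (Fin n) → ℝ) x := by
  obtain ⟨C, hC⟩ := BallSobolev.exists_ballHolder (p := p) n hρ hlam0 hlam1 hp hlam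
  choose g hgn hg using hC
  have hae : ∀ {P : EuclideanSpace ℝ (Fin n) → Prop}, (∀ᵐ x ∂ballMeasure n ρ, P x) →
      ∀ᵐ x : EuclideanSpace ℝ (Fin n), x ∈ Metric.ball 0 ρ → P x :=
    fun h => (ae_restrict_iff' measurableSet_ball).1 h
  -- The versions `g` are merely chosen; they depend linearly on `u` because a Hölder function is
  -- determined by its a.e. values.
  let J : BallSobolev n p ρ →ₗ[ℝ] BallHolder n lam ρ :=
    { toFun := g
      map_add' := fun u v => by
        refine BallHolder.ext_ae hρ ?_
        filter_upwards [hg u, hg v, hg (u + v), hae (Lp.coeFn_add (toLp u) (toLp v))]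
          with x h1 h2 h3 h4 hx
        rw [h3 hx, map_add, h4 hx, map_add, ContinuousMap.add_apply, h1 hx, h2 hx, Pi.add_apply]
      map_smul' := fun c u => by
        refine BallHolder.ext_ae hρ ?_
        filter_upwards [hg u, hg (c • u), hae (Lp.coeFn_smul c (toLp u))] with x h1 h2 h3 hx
        rw [h2 hx, map_smul, h3 hx, RingHom.id_apply, map_smul, ContinuousMap.smul_apply, h1 hx,
          Pi.smul_apply] }
  refine ⟨J.mkContinuous C hgn, fun u v huv => ?_, hg⟩
  refine Subtype.ext (Lp.ext ?_)
  refine (ae_restrict_iff' measurableSet_ball).2 ?_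
  filter_upwards [hg u, hg v] with x h1 h2 hx
  have huv' : g u = g v := huv
  have h3 := h1 hx
  rw [huv', h2 hx] at h3
  exact h3.symm

end HolderEmbedding

end OrliczSobolev

namespace OrliczSobolev

/-! ## Restriction of the Gaussian Orlicz spaces to balls -/

section Young

theorem abs_rpow_le_one_add_pow (x : ℝ) {q : ℝ} (hq : 0 ≤ q) {k : ℕ} (hk : q ≤ k) :
    |x| ^ q ≤ 1 + |x| ^ k := by
  rcases le_total |x| 1 with h | h
  · have := Real.rpow_le_one (abs_nonneg x) h hq
    have := pow_nonneg (abs_nonneg x) k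
    linarith
  · have := Real.rpow_le_rpow_of_exponent_le h hk
    rw [Real.rpow_natCast] at this
    linarith

/-- For an integer `k ≥ q`, `|x|^q ≤ 1 + |x|^k` and `|x|^k ≤ k! · exp |x| ≤ 2 k! · cosh x`. -/
theorem exists_abs_rpow_le_cosh₂ {q : ℝ} (hq : 0 ≤ q) :
    ∃ A : ℝ, 0 ≤ A ∧ ∀ x, |x| ^ q ≤ A + A * cosh₂ x := by
  obtain ⟨k, hk⟩ := exists_nat_ge q
  refine ⟨1 + 2 * k.factorial, by positivity, fun x => ?_⟩
  have h1 := abs_rpow_le_one_add_pow x hq hk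
  have h2 := Real.pow_div_factorial_le_exp |x| (abs_nonneg x) k
  rw [div_le_iff₀ (by positivity)] at h2
  have h3 : Real.exp |x| ≤ 2 * Real.cosh x := by
    rw [← Real.cosh_abs, Real.cosh_eq]
    have := Real.exp_pos (-|x|)
    linarith
  have h4 : cosh₂ x = Real.cosh x - 1 := rfl
  have h5 : Real.exp |x| * k.factorial ≤ 2 * Real.cosh x * k.factorial := by gcongr
  have h6 := Real.one_le_cosh x
  rw [h4]
  linarith

theorem exists_abs_rpow_le_cosh₂_sq {q : ℝ} (hq : 0 ≤ q) :
    ∃ A : ℝ, 0 ≤ A ∧ ∀ x, |x| ^ q ≤ A + A * cosh₂.sq x := by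
  obtain ⟨A, hA, h⟩ := exists_abs_rpow_le_cosh₂ hq
  refine ⟨A + 1, by positivity, fun x => ?_⟩
  have h0 := cosh₂.nonneg (x ^ 2)
  have h1 : cosh₂.sq x = cosh₂ (x ^ 2) := rfl
  have h2 : |x| ^ q ≤ 1 + |x ^ 2| ^ q := by
    rcases le_total |x| 1 with hx | hx
    · have := Real.rpow_le_one (abs_nonneg x) hx hq
      have := Real.rpow_nonneg (abs_nonneg (x ^ 2)) q
      linarith
    · have : |x| ≤ |x ^ 2| := by
        rw [abs_pow]
        exact le_self_pow₀ hx two_ne_zero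
      have := Real.rpow_le_rpow (abs_nonneg x) this hq
      linarith
  have h3 := h (x ^ 2)
  rw [h1]
  linarith

end Young

/-! ### From Gaussian Orlicz and Orlicz–Sobolev spaces to balls -/

section Restrict

variable {n : ℕ}

/-- The density decreases radially, so on the ball it is at least its value `a` at radius `ρ`, and
`a⁻¹` serves as the constant. -/
theorem ballMeasure_le_gauss (n : ℕ) (ρ : ℝ) :
    ∃ c : ℝ≥0, ballMeasure n ρ ≤ (c : ℝ≥0∞) • gauss n := by
  set a : ℝ := (2 * Real.pi) ^ (-(n : ℝ) / 2) * Real.exp (-ρ ^ 2 / 2) with ha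
  have ha0 : 0 < a := by
    have := Real.pi_pos
    positivity
  refine ⟨a⁻¹.toNNReal, Measure.le_iff.2 fun s hs => ?_⟩
  rw [Measure.restrict_apply hs, Measure.smul_apply, gauss, withDensity_apply _ hs, smul_eq_mul,
    ← lintegral_const_mul' _ _ ENNReal.coe_ne_top]
  calc volume (s ∩ Metric.ball 0 ρ) = ∫⁻ x in s ∩ Metric.ball 0 ρ, 1 := by simp
    _ ≤ ∫⁻ x in s ∩ Metric.ball 0 ρ, ((a⁻¹.toNNReal : ℝ≥0) : ℝ≥0∞)
          * ENNReal.ofReal (gaussDensity x) := by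
        refine setLIntegral_mono' (hs.inter measurableSet_ball) fun x hx => ?_
        change 1 ≤ ENNReal.ofReal a⁻¹ * _
        rw [← ENNReal.ofReal_mul (by positivity), ← ENNReal.ofReal_one]
        refine ENNReal.ofReal_le_ofReal ?_
        rw [inv_mul_eq_div, one_le_div ha0, gaussDensity, ha]
        have := mem_ball_zero_iff.1 hx.2
        have h2 := norm_nonneg x
        gcongr
    _ ≤ _ := lintegral_mono_set inter_subset_left

theorem ballMeasure_absolutelyContinuous_gauss (n : ℕ) (ρ : ℝ) : ballMeasure n ρ ≪ gauss n :=
  (Measure.absolutelyContinuous_of_le Measure.restrict_le_self).trans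
    volume_absolutelyContinuous_gauss

/-- If `|x|^p` is dominated by `Φ`, restriction maps `L^Φ(γ)` boundedly to `L^p(B_ρ)`. -/
theorem exists_eLpNorm_restrictBall_le (n : ℕ) (ρ : ℝ) {Φ : YoungFunction} {p : ℝ≥0∞}
    (hp0 : p ≠ 0) (hp : p ≠ ⊤) {A : ℝ} (hA : 0 ≤ A) (hΦ : ∀ x, |x| ^ p.toReal ≤ A + A * Φ x) :
    ∃ C : ℝ, ∀ f : orlicz Φ (gauss n), eLpNorm (restrictBall ρ f) p (ballMeasure n ρ)
      ≤ ENNReal.ofReal (C * ‖f‖) := by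
  have hq : 0 < p.toReal := ENNReal.toReal_pos hp0 hp
  obtain ⟨c, hc⟩ := ballMeasure_le_gauss n ρ
  set B : ℝ≥0∞ := ENNReal.ofReal A * volume (Metric.ball (0 : EuclideanSpace ℝ (Fin n)) ρ)
    + ENNReal.ofReal A * c with hB
  have hBt : B ≠ ⊤ := by
    have := (measure_ball_lt_top (μ := volume) (x := (0 : EuclideanSpace ℝ (Fin n))) (r := ρ)).ne
    finiteness
  set D : ℝ≥0∞ := B ^ (1 / p.toReal) with hD
  have hDt : D ≠ ⊤ := ENNReal.rpow_ne_top_of_nonneg (by positivity) hBt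
  -- Each radius `r` admissible in the Luxemburg norm gives a bound linear in `r`, with `D`
  -- independent of `f`; the infimum over `r` then produces the norm.
  have key : ∀ (f : orlicz Φ (gauss n)) (r : ℝ), 0 < r →
      modular Φ (gauss n) (r⁻¹ • (f : EuclideanSpace ℝ (Fin n) →ₘ[gauss n] ℝ)) ≤ 1 →
      eLpNorm (restrictBall ρ f) p (ballMeasure n ρ) ≤ ENNReal.ofReal r * D := by
    intro f r hr hf
    have h1 : ∫⁻ x, ‖restrictBall ρ f x‖ₑ ^ p.toReal ∂ballMeasure n ρ
        ≤ ENNReal.ofReal r ^ p.toReal * B := by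
      calc ∫⁻ x, ‖restrictBall ρ f x‖ₑ ^ p.toReal ∂ballMeasure n ρ
          ≤ ∫⁻ x, ENNReal.ofReal r ^ p.toReal * (ENNReal.ofReal A + ENNReal.ofReal A *
              ENNReal.ofReal (Φ |(r⁻¹ • (f : EuclideanSpace ℝ (Fin n) →ₘ[gauss n] ℝ)) x|))
                ∂ballMeasure n ρ := by
            refine lintegral_mono_ae ?_
            filter_upwards [coeFn_restrictBall ρ (f : EuclideanSpace ℝ (Fin n) →ₘ[gauss n] ℝ),
              (ballMeasure_absolutelyContinuous_gauss n ρ).ae_le (AEEqFun.coeFn_smul r⁻¹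
                (f : EuclideanSpace ℝ (Fin n) →ₘ[gauss n] ℝ))] with x h2 h3
            rw [h2, h3, Pi.smul_apply, smul_eq_mul]
            set y := (f : EuclideanSpace ℝ (Fin n) →ₘ[gauss n] ℝ) x
            have h4 := hΦ |r⁻¹ * y|
            have hΦ0 := Φ.nonneg |r⁻¹ * y|
            rw [abs_abs] at h4
            rw [← ENNReal.ofReal_mul hA, ← ENNReal.ofReal_add hA (by positivity),
              ENNReal.ofReal_rpow_of_pos hr, ← ENNReal.ofReal_mul (by positivity),
              ← ofReal_norm, ENNReal.ofReal_rpow_of_nonneg (norm_nonneg _) hq.le]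
            refine ENNReal.ofReal_le_ofReal ?_
            have h5 : ‖y‖ = r * |r⁻¹ * y| := by
              rw [abs_mul, abs_of_pos (inv_pos.2 hr), mul_inv_cancel_left₀ hr.ne',
                Real.norm_eq_abs]
            rw [h5, Real.mul_rpow hr.le (abs_nonneg _)]
            gcongr
        _ ≤ ENNReal.ofReal r ^ p.toReal * B := by
            rw [lintegral_const_mul' _ _ (ENNReal.rpow_ne_top_of_nonneg hq.le ENNReal.ofReal_ne_top),
              lintegral_add_left measurable_const, lintegral_const, Measure.restrict_apply_univ,
              lintegral_const_mul' _ _ ENNReal.ofReal_ne_top, hB]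
            gcongr
            refine (lintegral_mono' hc le_rfl).trans ?_
            rw [lintegral_smul_measure, smul_eq_mul]
            exact mul_le_of_le_one_right' hf
    rw [eLpNorm_eq_lintegral_rpow_enorm_toReal hp0 hp, hD]
    refine (ENNReal.rpow_le_rpow h1 (by positivity)).trans_eq ?_
    rw [ENNReal.mul_rpow_of_nonneg _ _ (by positivity), ← ENNReal.rpow_mul,
      mul_one_div_cancel hq.ne', ENNReal.rpow_one]
  -- `D` may vanish; adding `1` makes the constant positive, so that it can be divided out before
  -- taking the infimum.
  refine ⟨D.toReal + 1, fun f => ?_⟩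
  have hD1 : 0 < D.toReal + 1 := by positivity
  obtain ⟨r₀, hr₀, hf₀⟩ := f.2
  have ht : eLpNorm (restrictBall ρ f) p (ballMeasure n ρ) ≠ ⊤ :=
    ((key f r₀ hr₀ hf₀).trans_lt (by finiteness)).ne
  have hn : ‖f‖ = sInf {r : ℝ | 0 < r ∧
      modular Φ (gauss n) (r⁻¹ • (f : EuclideanSpace ℝ (Fin n) →ₘ[gauss n] ℝ)) ≤ 1} :=
    luxemburgNorm_eq_sInf Φ (gauss n) f
  rw [ENNReal.le_ofReal_iff_toReal_le ht (by positivity), ← div_le_iff₀' hD1, hn]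
  refine le_csInf ⟨r₀, hr₀, hf₀⟩ fun r hr => ?_
  rw [div_le_iff₀' hD1]
  have h1 := ENNReal.toReal_mono (by finiteness) (key f r hr.1 hr.2)
  rw [ENNReal.toReal_mul, ENNReal.toReal_ofReal hr.1.le] at h1
  nlinarith [hr.1]

theorem exists_restrictLp (n : ℕ) (ρ : ℝ) {Φ : YoungFunction} {p : ℝ≥0∞} [Fact (1 ≤ p)]
    (hp : p ≠ ⊤) {A : ℝ} (hA : 0 ≤ A) (hΦ : ∀ x, |x| ^ p.toReal ≤ A + A * Φ x) :
    ∃ T : orlicz Φ (gauss n) →L[ℝ] Lp ℝ p (ballMeasure n ρ), ∀ f : orlicz Φ (gauss n),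
      (T f : EuclideanSpace ℝ (Fin n) →ₘ[ballMeasure n ρ] ℝ)
        = restrictBall ρ (f : EuclideanSpace ℝ (Fin n) →ₘ[gauss n] ℝ) := by
  have hp1 : 1 ≤ p := Fact.out
  obtain ⟨C, hC⟩ := exists_eLpNorm_restrictBall_le n ρ (one_pos.trans_le hp1).ne' hp hA hΦ
  let T : orlicz Φ (gauss n) →ₗ[ℝ] Lp ℝ p (ballMeasure n ρ) :=
    { toFun := fun f => ⟨restrictBall ρ f,
        Lp.mem_Lp_iff_eLpNorm_lt_top.2 ((hC f).trans_lt ENNReal.ofReal_lt_top)⟩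
      map_add' := fun f g => Subtype.ext (restrictBall_add ρ _ _)
      map_smul' := fun c f => Subtype.ext (restrictBall_smul ρ c _) }
  refine ⟨T.mkContinuous (max C 0) fun f => ?_, fun f => rfl⟩
  rw [Lp.norm_def]
  refine ENNReal.toReal_le_of_le_ofReal (by positivity) ((hC f).trans ?_)
  gcongr
  exact le_max_left _ _

theorem integral_gauss (f : EuclideanSpace ℝ (Fin n) → ℝ) :
    ∫ x, f x ∂gauss n = ∫ x, gaussDensity x * f x := by
  rw [gauss, integral_withDensity_eq_integral_toReal_smul
    continuous_gaussDensity.measurable.ennreal_ofReal (by simp)]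
  refine integral_congr_ae (Filter.Eventually.of_forall fun x => ?_)
  simp only [ENNReal.toReal_ofReal (gaussDensity_pos x).le, smul_eq_mul]

theorem contDiff_gaussDensity {k : WithTop ℕ∞} : ContDiff ℝ k (gaussDensity (n := n)) := by
  unfold gaussDensity
  exact contDiff_const.mul (((contDiff_norm_sq ℝ).neg.div_const _).exp)

theorem partialDeriv_gaussDensity (i : Fin n) (x : EuclideanSpace ℝ (Fin n)) :
    partialDeriv i gaussDensity x = -(x i * gaussDensity x) := by
  have h1 : HasFDerivAt (fun y : EuclideanSpace ℝ (Fin n) => ‖y‖ ^ 2) _ x :=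
    (hasStrictFDerivAt_norm_sq x).hasFDerivAt
  have h2 := ((h1.neg.mul_const (2 : ℝ)⁻¹).exp).const_mul ((2 * Real.pi) ^ (-(n : ℝ) / 2))
  have h3 : HasFDerivAt (gaussDensity (n := n)) _ x := h2
  rw [partialDeriv, h3.fderiv, gaussDensity]
  have h4 : -‖x‖ ^ 2 / 2 = -(‖x‖ ^ 2 * 2⁻¹) := by ring
  simp [EuclideanSpace.inner_single_right, h4]
  ring

/-- Test the Gaussian identity with `φ = ψ / γ`. Since `∂ᵢγ = -xᵢγ`, the product rule gives `∂ᵢψ =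
-γ · δᵢφ`, and the densities cancel. -/
theorem IsGaussWeakDeriv.isBallWeakDeriv (ρ : ℝ) {i : Fin n}
    {f g : EuclideanSpace ℝ (Fin n) →ₘ[gauss n] ℝ} (h : IsGaussWeakDeriv i f g) :
    IsBallWeakDeriv ρ i (restrictBall ρ f) (restrictBall ρ g) := by
  intro ψ hψ hc hs
  have hψ1 : ContDiff ℝ 1 ψ := hψ.of_le (by exact_mod_cast le_top)
  have hγ : ContDiff ℝ 1 (gaussDensity (n := n)) := contDiff_gaussDensity
  have hγ0 : ∀ x : EuclideanSpace ℝ (Fin n), gaussDensity x ≠ 0 := fun x => (gaussDensity_pos x).ne'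
  set φ : EuclideanSpace ℝ (Fin n) → ℝ := fun x => (gaussDensity x)⁻¹ * ψ x with hφ
  have hφ1 : ContDiff ℝ 1 φ := (hγ.inv hγ0).mul hψ1
  have hψφ : ψ = fun x => gaussDensity x * φ x := by
    funext x
    rw [hφ, mul_inv_cancel_left₀ (hγ0 x)]
  have hd : ∀ x, partialDeriv i ψ x = -(gaussDensity x * gaussDiv i φ x) := by
    intro x
    have h1 := (hγ.differentiable one_ne_zero x).hasFDerivAt.mul
      (hφ1.differentiable one_ne_zero x).hasFDerivAt
    have h2 : HasFDerivAt ψ _ x := h1.congr_of_eventuallyEq (Filter.Eventually.of_forall (congrFun hψφ))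
    have h3 := partialDeriv_gaussDensity i x
    rw [partialDeriv] at h3
    rw [gaussDiv, partialDeriv, partialDeriv, h2.fderiv]
    simp only [add_apply, smul_apply, smul_eq_mul, h3]
    ring
  have key := h φ hφ1 (hc.mul_left)
  rw [integral_gauss, integral_gauss] at key
  have hr : ∀ (k : EuclideanSpace ℝ (Fin n) →ₘ[gauss n] ℝ) (χ : EuclideanSpace ℝ (Fin n) → ℝ),
      (∀ x, x ∉ Metric.ball 0 ρ → χ x = 0) →
      ∫ x in Metric.ball 0 ρ, restrictBall ρ k x * χ x = ∫ x, k x * χ x := by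
    intro k χ hχ
    refine (integral_congr_ae ?_).trans (setIntegral_eq_integral_of_forall_compl_eq_zero
      (s := Metric.ball 0 ρ) (f := fun x => k x * χ x) fun x hx => by rw [hχ x hx, mul_zero])
    filter_upwards [coeFn_restrictBall ρ k] with x hx
    rw [hx]
  rw [hr g ψ fun x hx => image_eq_zero_of_notMem_tsupport fun h' => hx (hs h'),
    hr f (partialDeriv i ψ) fun x hx => ?_, ← integral_neg]
  · calc ∫ x, g x * ψ x = ∫ x, gaussDensity x * (g x * φ x) := by
          rw [hψφ]
          congr 1 with x
          ring
      _ = _ := key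
      _ = _ := by
          congr 1 with x
          rw [hd x]
          ring
  · have h1 := (tsupport_fderiv_subset ℝ (f := ψ)).trans hs
    have h2 : fderiv ℝ ψ x = 0 := image_eq_zero_of_notMem_tsupport fun h' => hx (h1 h')
    rw [partialDeriv, h2]
    rfl

/-- Uniqueness of the weak gradient identifies the operator's value with any explicit candidate, so
that its norm can be estimated. -/
theorem BallSobolev.weakDeriv_eq {p : ℝ≥0∞} [Fact (1 ≤ p)] {ρ : ℝ} (u : BallSobolev n p ρ)
    (g : Fin n → Lp ℝ p (ballMeasure n ρ))
    (h : ∀ i, IsBallWeakDeriv ρ i (toLp u : EuclideanSpace ℝ (Fin n) →ₘ[ballMeasure n ρ] ℝ) (g i))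
    (i : Fin n) : weakDeriv i u = g i := by
  have h1 : ((toLp u, fun i => weakDeriv i u) : _ × (Fin n → Lp ℝ p (ballMeasure n ρ)))
      ∈ ballGradGraph n p ρ := fun i => u.isBallWeakDeriv i
  have h2 : ((toLp u, g) : _ × (Fin n → Lp ℝ p (ballMeasure n ρ))) ∈ ballGradGraph n p ρ := h
  have h3 := ballGradGraph_unique p ρ _ (sub_mem h1 h2) (sub_self _)
  exact sub_eq_zero.1 (congrFun h3 i)

/-- Restriction of `W¹L^{cosh₂}_{1,2}(γ)` to `B_ρ`. -/
theorem GaussSobolev.exists_restrict (n : ℕ) (ρ : ℝ) {p : ℝ≥0∞} [Fact (1 ≤ p)] (hp : p ≠ ⊤) :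
    ∃ R : GaussSobolev n →L[ℝ] BallSobolev n p ρ, ∀ f : GaussSobolev n,
      (BallSobolev.toLp (R f) : EuclideanSpace ℝ (Fin n) →ₘ[ballMeasure n ρ] ℝ)
        = restrictBall ρ (toSubExp n f : EuclideanSpace ℝ (Fin n) →ₘ[gauss n] ℝ) := by
  obtain ⟨A, hA, hAΦ⟩ := exists_abs_rpow_le_cosh₂ (q := p.toReal) ENNReal.toReal_nonneg
  obtain ⟨A', hA', hAΦ'⟩ := exists_abs_rpow_le_cosh₂_sq (q := p.toReal) ENNReal.toReal_nonneg
  obtain ⟨T, hT⟩ := exists_restrictLp n ρ hp hA hAΦ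
  obtain ⟨T', hT'⟩ := exists_restrictLp n ρ hp hA' hAΦ'
  have hw : ∀ (f : GaussSobolev n) (i : Fin n), IsBallWeakDeriv ρ i
      (T (toSubExp n f) : EuclideanSpace ℝ (Fin n) →ₘ[ballMeasure n ρ] ℝ)
      (T' (weakDeriv i f)) := by
    intro f i
    rw [hT, hT']
    exact (gaussGrad_spec f i).isBallWeakDeriv ρ
  let R : GaussSobolev n →ₗ[ℝ] BallSobolev n p ρ :=
    LinearMap.codRestrict (ballGrad n p ρ).domain ((T : SubExp n →ₗ[ℝ] _).comp (toSubExp n))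
      fun f => mem_ballGrad_domain.2 fun i => ⟨_, hw f i⟩
  refine ⟨R.mkContinuous (‖T‖ + ‖T'‖) fun f => ?_, fun f => hT _⟩
  have hR : BallSobolev.toLp (R f) = T (toSubExp n f) := rfl
  -- The weak derivatives of the restriction are the restrictions of the Gaussian ones, so they are
  -- bounded through `T'`.
  have hRd : ∀ i, BallSobolev.weakDeriv i (R f) = T' (weakDeriv i f) :=
    (R f).weakDeriv_eq (fun i => T' (weakDeriv i f)) (hw f)
  rw [BallSobolev.norm_eq, hR, norm_eq]
  simp only [hRd]
  have h1 := T.le_opNorm (toSubExp n f)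
  have h2 : ∑ i, ‖T' (weakDeriv i f)‖ ≤ ‖T'‖ * ∑ i, ‖weakDeriv i f‖ := by
    rw [Finset.mul_sum]
    exact Finset.sum_le_sum fun i _ => T'.le_opNorm _
  have h3 : 0 ≤ ∑ i, ‖weakDeriv i f‖ := Finset.sum_nonneg fun i _ => norm_nonneg _
  have h4 := norm_nonneg T
  have h5 := norm_nonneg T'
  have h6 := norm_nonneg (toSubExp n f)
  nlinarith [mul_nonneg h4 h3, mul_nonneg h5 h6]

end Restrict

end OrliczSobolev

namespace OrliczSobolev

/-! ## The intersection spaces -/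

section Intersection

variable {n : ℕ}

namespace LocSobolevSubExp

theorem toSubExp_injective : Function.Injective (toSubExp n) := Subtype.val_injective

theorem continuous_toSubExp : Continuous (toSubExp n) :=
  continuous_iff_le_induced.2 inf_le_left

theorem continuous_restrict (p : ℝ≥0∞) [hp1 : Fact (1 ≤ p)] (hp : p ≠ ⊤) (ρ : ℝ) (hρ : 0 < ρ) :
    Continuous (restrict (n := n) p hp ρ hρ) :=
  continuous_iff_le_induced.2 (inf_le_right.trans
    (iInf_le_of_le p (iInf_le_of_le hp1 (iInf_le_of_le hp (iInf_le_of_le ρ (iInf_le _ hρ))))))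

theorem continuous_iff {X : Type*} [TopologicalSpace X] {F : X → LocSobolevSubExp n} :
    Continuous F ↔ Continuous (fun x => toSubExp n (F x)) ∧
      ∀ (p : ℝ≥0∞) [Fact (1 ≤ p)] (hp : p ≠ ⊤) (ρ : ℝ) (hρ : 0 < ρ),
        Continuous fun x => restrict p hp ρ hρ (F x) := by
  refine ⟨fun h => ⟨continuous_toSubExp.comp h, fun p _ hp ρ hρ =>
    (continuous_restrict p hp ρ hρ).comp h⟩, fun h => ?_⟩
  refine continuous_iff_coinduced_le.2 (le_inf
    (continuous_iff_coinduced_le.1 (continuous_induced_rng.2 h.1)) ?_)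
  refine le_iInf fun p => le_iInf fun hp1 => le_iInf fun hp => le_iInf fun ρ => le_iInf fun hρ =>
    continuous_iff_coinduced_le.1 (continuous_induced_rng.2 ?_)
  exact h.2 p hp ρ hρ

end LocSobolevSubExp

/-- Makes the choice inside `LocSobolevSubExp.restrict` immaterial: any map with the same a.e.
values coincides with it. -/
theorem BallSobolev.ext_toLp {p : ℝ≥0∞} [Fact (1 ≤ p)] {ρ : ℝ} {u v : BallSobolev n p ρ}
    (h : (toLp u : EuclideanSpace ℝ (Fin n) →ₘ[ballMeasure n ρ] ℝ) = toLp v) : u = v :=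
  Subtype.ext (Subtype.ext h)

/-- The inclusion of `W¹L^{cosh₂}_{1,2}(γ)` in `⋂ W^{1,p}_loc ∩ L^{cosh₂}_1(γ)`. -/
theorem GaussSobolev.exists_toLocSobolev (n : ℕ) :
    ∃ I : GaussSobolev n →L[ℝ] LocSobolevSubExp n, Function.Injective I ∧
      ∀ f : GaussSobolev n, LocSobolevSubExp.toSubExp n (I f) = toSubExp n f := by
  let I : GaussSobolev n →ₗ[ℝ] LocSobolevSubExp n :=
    LinearMap.codRestrict (locSobolevSubmodule n) (toSubExp n) fun f p _ hp ρ _ => by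
      obtain ⟨R, hR⟩ := exists_restrict n ρ hp
      exact ⟨R f, hR f⟩
  have hI : ∀ f, LocSobolevSubExp.toSubExp n (I f) = toSubExp n f := fun f => rfl
  refine ⟨⟨I, LocSobolevSubExp.continuous_iff.2 ⟨?_, fun p _ hp ρ hρ => ?_⟩⟩, ?_, hI⟩
  · exact (toSubExp n).mkContinuous 1 (fun f => by
      rw [one_mul, norm_eq f]
      exact le_add_of_nonneg_right (Finset.sum_nonneg fun i _ => norm_nonneg _)) |>.continuous
  · obtain ⟨R, hR⟩ := exists_restrict n ρ hp
    refine R.continuous.congr fun f => BallSobolev.ext_toLp ?_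
    rw [hR, LocSobolevSubExp.toLp_restrict]
    rfl
  · intro f g hfg
    exact Subtype.ext (congrArg (LocSobolevSubExp.toSubExp n) hfg)

theorem gauss_absolutelyContinuous_volume (n : ℕ) :
    gauss n ≪ (volume : Measure (EuclideanSpace ℝ (Fin n))) :=
  withDensity_absolutelyContinuous _ _

instance : (gauss n).IsOpenPosMeasure := volume_absolutelyContinuous_gauss.isOpenPosMeasure

/-- `γ` charges every nonempty open set, so continuous functions that agree `γ`-a.e. are equal. -/
theorem ContinuousSubExp.toSubExp_injective : Function.Injective (toSubExp n) := by
  intro g h hgh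
  refine Subtype.ext (ContinuousMap.ext fun x => congrFun (Continuous.ae_eq_iff_eq (gauss n)
    (toContinuousMap n g).continuous (toContinuousMap n h).continuous |>.1 ?_) x)
  have h1 := coeFn_toSubExp g
  rw [hgh] at h1
  exact h1.symm.trans (coeFn_toSubExp h)

/-- Two pieces both agree a.e. with `f` on the intersection of their open balls, so by continuity
they agree there everywhere. Gluing over the open balls of radius `k + 1` is then possible, and each
contains the closed ball of radius `k`. -/
theorem exists_continuousMap_of_balls {G : ∀ k : ℕ,
      C(Metric.closedBall (0 : EuclideanSpace ℝ (Fin n)) (k + 1), ℝ)}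
    {f : EuclideanSpace ℝ (Fin n) → ℝ}
    (h : ∀ k : ℕ, ∀ᵐ x : EuclideanSpace ℝ (Fin n), ∀ hx : x ∈ Metric.ball 0 ((k : ℝ) + 1),
      G k ⟨x, Metric.ball_subset_closedBall hx⟩ = f x) :
    ∃ g : C(EuclideanSpace ℝ (Fin n), ℝ), (∀ᵐ x : EuclideanSpace ℝ (Fin n), g x = f x) ∧
      ∀ k : ℕ, ∀ x : Metric.closedBall (0 : EuclideanSpace ℝ (Fin n)) k,
        g x = G k ⟨x, Metric.closedBall_subset_closedBall (by linarith) x.2⟩ := by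
  classical
  let B : ℕ → Set (EuclideanSpace ℝ (Fin n)) := fun k => Metric.ball 0 ((k : ℝ) + 1)
  let F : ∀ k : ℕ, C(B k, ℝ) := fun k =>
    (G k).comp ⟨inclusion Metric.ball_subset_closedBall, continuous_inclusion _⟩
  have hF : ∀ (i j : ℕ) (x : EuclideanSpace ℝ (Fin n)) (hxi : x ∈ B i) (hxj : x ∈ B j),
      F i ⟨x, hxi⟩ = F j ⟨x, hxj⟩ := by
    intro i j x hxi hxj
    let E : ∀ k : ℕ, EuclideanSpace ℝ (Fin n) → ℝ := fun k y =>
      if hy : y ∈ B k then F k ⟨y, hy⟩ else 0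
    have hE : ∀ k, ∀ y : B k, E k y = F k y := fun k y => dif_pos y.2
    have hEc : ∀ k, ContinuousOn (E k) (B k) := fun k => by
      rw [continuousOn_iff_continuous_domRestrict]
      exact (F k).continuous.congr fun y => (hE k y).symm
    have hopen : IsOpen (B i ∩ B j) := Metric.isOpen_ball.inter Metric.isOpen_ball
    have hae : E i =ᵐ[volume.restrict (B i ∩ B j)] E j := by
      refine (ae_restrict_iff' hopen.measurableSet).2 ?_
      filter_upwards [h i, h j] with y h1 h2 hy
      exact (hE i ⟨y, hy.1⟩).trans ((h1 hy.1).trans ((h2 hy.2).symm.trans (hE j ⟨y, hy.2⟩).symm))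
    have := Measure.eqOn_open_of_ae_eq hae hopen ((hEc i).mono inter_subset_left)
      ((hEc j).mono inter_subset_right) ⟨hxi, hxj⟩
    rw [← hE i ⟨x, hxi⟩, ← hE j ⟨x, hxj⟩]
    exact this
  have hB : ∀ x : EuclideanSpace ℝ (Fin n), ∃ k : ℕ, B k ∈ nhds x := fun x => by
    obtain ⟨k, hk⟩ := exists_nat_gt ‖x‖
    exact ⟨k, Metric.isOpen_ball.mem_nhds (mem_ball_zero_iff.2 (by linarith))⟩
  refine ⟨ContinuousMap.liftCover B F hF hB, ?_, fun k x => ?_⟩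
  · filter_upwards [ae_all_iff.2 h] with x hx
    obtain ⟨k, hk⟩ := hB x
    have hxk : x ∈ B k := mem_of_mem_nhds hk
    rw [← hx k hxk]
    exact ContinuousMap.liftCover_coe (φ := F) (hφ := hF) (hS := hB) ⟨x, hxk⟩
  · have hxk : (x : EuclideanSpace ℝ (Fin n)) ∈ B k :=
      Metric.closedBall_subset_ball (by linarith) x.2
    exact ContinuousMap.liftCover_coe (φ := F) (hφ := hF) (hS := hB) ⟨x, hxk⟩

/-- Every compact set lies in a closed ball of integer radius, so these balls suffice to test
convergence in the compact-open topology. -/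
theorem continuous_continuousMap_of_closedBall {X : Type*} [TopologicalSpace X]
    {F : X → C(EuclideanSpace ℝ (Fin n), ℝ)}
    (h : ∀ k : ℕ, Continuous fun x =>
      (F x).restrict (Metric.closedBall (0 : EuclideanSpace ℝ (Fin n)) k)) : Continuous F := by
  rw [continuous_iff_continuousAt]
  intro x
  refine (ContinuousMap.tendsto_compactOpen_iff_forall _ _).2 fun s hs => ?_
  obtain ⟨r, hr⟩ := hs.isBounded.subset_closedBall (0 : EuclideanSpace ℝ (Fin n))
  obtain ⟨k, hk⟩ := exists_nat_ge r
  have hsk := hr.trans (Metric.closedBall_subset_closedBall hk)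
  exact (((ContinuousMap.continuous_precomp
    ⟨inclusion hsk, continuous_inclusion hsk⟩).comp (h k)).tendsto x :)

/-- Elements of `⋂ W^{1,p}_loc ∩ L^{cosh₂}_1(γ)` have continuous versions, which depend
continuously on them. -/
theorem LocSobolevSubExp.exists_toContinuousSubExp (n : ℕ) (hn : 1 ≤ n) :
    ∃ K : LocSobolevSubExp n →L[ℝ] ContinuousSubExp n, Function.Injective K ∧
      ∀ f : LocSobolevSubExp n, ContinuousSubExp.toSubExp n (K f) = toSubExp n f := by
  have hn' : (1 : ℝ) ≤ n := by exact_mod_cast hn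
  -- With `λ = 1/2` the condition `n / p ≤ 1 - λ` is an equality; `n ≥ 1` ensures `p ≥ 1`.
  let p : ℝ≥0∞ := ENNReal.ofReal (2 * n)
  have hp : p ≠ ⊤ := ENNReal.ofReal_ne_top
  have hpr : p.toReal = 2 * n := ENNReal.toReal_ofReal (by positivity)
  have : Fact (1 ≤ p) := ⟨ENNReal.one_le_ofReal.2 (by linarith)⟩
  have hk : ∀ k : ℕ, (0 : ℝ) < k + 1 := fun k => by positivity
  have hlam : (n : ℝ) / p.toReal ≤ 1 - ((1 / 2 : ℝ≥0) : ℝ) := by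
    rw [hpr]
    push_cast
    rw [div_le_iff₀ (by positivity)]
    linarith
  have hJ := fun k : ℕ => BallSobolev.exists_embedding (p := p) n (hk k)
    (lam := 1 / 2) (by positivity) (by rw [div_le_iff₀] <;> norm_num) hp hlam
  choose J _ hJ using hJ
  have hG : ∀ (f : LocSobolevSubExp n) (k : ℕ), ∀ᵐ x : EuclideanSpace ℝ (Fin n),
      ∀ hx : x ∈ Metric.ball 0 ((k : ℝ) + 1),
        BallHolder.toContinuousMap (J k (restrict p hp _ (hk k) f))
          ⟨x, Metric.ball_subset_closedBall hx⟩
          = (toSubExp n f : EuclideanSpace ℝ (Fin n) →ₘ[gauss n] ℝ) x := by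
    intro f k
    have h2 := coeFn_restrictBall ((k : ℝ) + 1)
      (toSubExp n f : EuclideanSpace ℝ (Fin n) →ₘ[gauss n] ℝ)
    rw [← toLp_restrict p hp _ (hk k) f] at h2
    filter_upwards [hJ k (restrict p hp _ (hk k) f),
      (ae_restrict_iff' measurableSet_ball).1 h2] with x h1 h2 hx
    rw [h1 hx, h2 hx]
  choose g hgae hgk using fun f => exists_continuousMap_of_balls (hG f)
  have hgs : ∀ f, (g f).toAEEqFun (gauss n) = (toSubExp n f : EuclideanSpace ℝ (Fin n) →ₘ[gauss n] ℝ) := by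
    intro f
    refine AEEqFun.ext ((ContinuousMap.coeFn_toAEEqFun (gauss n) (g f)).trans ?_)
    exact (gauss_absolutelyContinuous_volume n).ae_le (hgae f)
  let k : LocSobolevSubExp n → ContinuousSubExp n := fun f =>
    (⟨g f, by
      rw [Submodule.mem_comap]
      change (g f).toAEEqFun (gauss n) ∈ SubExp n
      rw [hgs f]
      exact (toSubExp n f).2⟩ :
      (SubExp n).comap (ContinuousMap.toAEEqFunLinearMap (α := EuclideanSpace ℝ (Fin n))
        (γ := ℝ) (𝕜 := ℝ) (gauss n)))
  have hks : ∀ f, ContinuousSubExp.toSubExp n (k f) = toSubExp n f := fun f =>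
    Subtype.ext (hgs f)
  -- Linearity is checked after the injective inclusion in `L^{cosh₂}_1(γ)`, where `k` does not
  -- change the class.
  let K : LocSobolevSubExp n →ₗ[ℝ] ContinuousSubExp n :=
    { toFun := k
      map_add' := fun f f' => ContinuousSubExp.toSubExp_injective (by
        simp only [hks, map_add])
      map_smul' := fun c f => ContinuousSubExp.toSubExp_injective (by
        simp only [hks, map_smul, RingHom.id_apply]) }
  refine ⟨⟨K, ?_⟩, fun f f' hff => toSubExp_injective ?_, hks⟩
  · refine continuous_inf_rng.2 ⟨continuous_induced_rng.2 ?_, continuous_induced_rng.2 ?_⟩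
    · refine continuous_continuousMap_of_closedBall fun i => ?_
      have hH : Continuous (BallHolder.toContinuousMap (n := n) (lam := 1 / 2) (ρ := (i : ℝ) + 1)) :=
        (BallHolder.toContinuousMap.mkContinuous 1 fun u => by
          rw [one_mul, BallHolder.norm_eq]
          exact le_add_of_nonneg_right (by positivity)).continuous
      have hsub : Metric.closedBall (0 : EuclideanSpace ℝ (Fin n)) (i : ℝ)
          ⊆ Metric.closedBall 0 ((i : ℝ) + 1) :=
        Metric.closedBall_subset_closedBall (by linarith)
      refine ((ContinuousMap.continuous_precomp ⟨inclusion hsub, continuous_inclusion hsub⟩).comp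
        (hH.comp ((J i).continuous.comp (continuous_restrict p hp _ (hk i))))).congr fun f => ?_
      ext x
      exact (hgk f i x).symm
    · exact continuous_toSubExp.congr fun f => (hks f).symm
  · rw [← hks f, ← hks f']
    exact congrArg (ContinuousSubExp.toSubExp n) hff

end Intersection

end OrliczSobolev

/-! ### Assembly of the embeddings -/

theorem mainTheorem2 (n : ℕ) (hn : 1 ≤ n) :
    -- (1) restriction `W¹L^{cosh₂}_{1,2}(γ) → W^{1,α}(B_ρ)`
    (∀ (ρ : ℝ) (α : ℝ≥0∞) [Fact (1 ≤ α)], 0 < ρ → α ≠ ⊤ →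
      ∃ R : GaussSobolev n →L[ℝ] BallSobolev n α ρ, ∀ f : GaussSobolev n,
        (BallSobolev.toLp (R f) : EuclideanSpace ℝ (Fin n) → ℝ)
          =ᵐ[volume.restrict (Metric.ball 0 ρ)]
            (GaussSobolev.toSubExp n f : EuclideanSpace ℝ (Fin n) →ₘ[gauss n] ℝ)) ∧
    -- (1) embedding `W^{1,α}(B_ρ) ⊂ C^λ(closed B_ρ)` for `α ≥ n / (1 - λ)`
    (∀ (ρ : ℝ) (lam : ℝ≥0) (α : ℝ≥0∞) [Fact (1 ≤ α)], 0 < ρ → 0 < lam → lam < 1 → α ≠ ⊤ →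
      (n : ℝ) / (1 - (lam : ℝ)) ≤ α.toReal →
      ∃ J : BallSobolev n α ρ →L[ℝ] BallHolder n lam ρ, Function.Injective J ∧
        ∀ u : BallSobolev n α ρ, ∀ᵐ x : EuclideanSpace ℝ (Fin n), ∀ hx : x ∈ Metric.ball 0 ρ,
          BallHolder.toContinuousMap (J u) ⟨x, Metric.ball_subset_closedBall hx⟩
            = (BallSobolev.toLp u : EuclideanSpace ℝ (Fin n) → ℝ) x) ∧
    -- (2) inclusion in `⋂_α W^{1,α}_loc ∩ L^{cosh₂}_1(γ)`
    (∃ I : GaussSobolev n →L[ℝ] LocSobolevSubExp n, Function.Injective I ∧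
      ∀ f : GaussSobolev n, LocSobolevSubExp.toSubExp n (I f) = GaussSobolev.toSubExp n f) ∧
    -- (2) inclusion in `C(ℝⁿ) ∩ L^{cosh₂}_1(γ)`
    (∃ K : LocSobolevSubExp n →L[ℝ] ContinuousSubExp n, Function.Injective K ∧
      ∀ f : LocSobolevSubExp n,
        ContinuousSubExp.toSubExp n (K f) = LocSobolevSubExp.toSubExp n f) ∧
    -- every element has a continuous version
    (∀ f : GaussSobolev n, ∃ g : C(EuclideanSpace ℝ (Fin n), ℝ),
      (GaussSobolev.toSubExp n f : EuclideanSpace ℝ (Fin n) →ₘ[gauss n] ℝ)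
        =ᵐ[gauss n] g) := by
  refine ⟨fun ρ α _ _ hα => ?_, fun ρ lam α _ hρ hlam0 hlam1 hα hlam => ?_,
    GaussSobolev.exists_toLocSobolev n, LocSobolevSubExp.exists_toContinuousSubExp n hn,
    fun f => ?_⟩
  · obtain ⟨R, hR⟩ := GaussSobolev.exists_restrict n ρ hα
    refine ⟨R, fun f => ?_⟩
    have h := coeFn_restrictBall ρ
      (GaussSobolev.toSubExp n f : EuclideanSpace ℝ (Fin n) →ₘ[gauss n] ℝ)
    rwa [← hR f] at h
  · have hlam1' : (lam : ℝ) < 1 := by exact_mod_cast hlam1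
    have hα0 : 0 < α.toReal := ENNReal.toReal_pos (one_pos.trans_le Fact.out).ne' hα
    refine BallSobolev.exists_embedding n hρ hlam0 hlam1.le hα ?_
    -- Both forms of the exponent condition say `n ≤ α (1 - λ)`.
    rw [div_le_iff₀ (by linarith)] at hlam
    rw [div_le_iff₀ hα0]
    linarith
  · obtain ⟨I, _, hI⟩ := GaussSobolev.exists_toLocSobolev n
    obtain ⟨K, _, hK⟩ := LocSobolevSubExp.exists_toContinuousSubExp n hn
    refine ⟨ContinuousSubExp.toContinuousMap n (K (I f)), ?_⟩
    rw [← hI f, ← hK (I f)]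
    exact ContinuousSubExp.coeFn_toSubExp _
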